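/- Let $f_0(z)=e^{z/(1-z)}$ and $f_1(z)=e^{x}E_1(x)$ with $x=1/(1-z)$, $E_1(x)=\int_x^\infty \frac{e^{-t}}{t}\,dt$. Let $a_n=[z^n]f_0(z)$ and $b_n=[z^n]f_1(z)$ be their Maclaurin coefficients, and let $\rho_n=a_nb_n$. Let $\mu(h)=h^{-1}-(e^h-1)^{-1}-\tfrac12$ (a power series without constant term), and for $m,k\ge 0$ define the rational numbers \[ c_m=(-1)^m\sum_{j=0}^m [h^{m-j}]\exp(\mu(h))\,\frac{(m-2j+3/2)_{2j}}{4^j\,j!},\qquad d_k=\sum_{j=0}^{2k}(-1)^jc_jc_{2k-j},\qquad r_k=2^{6k}d_k, \] where $(x)_n=x(x+1)\cdots(x+n-1)$. Then $k!\,r_k\in\mathbb Z$ for all $k\ge 0$. The same holds if the $d_k$ are introduced as the coefficients of the asymptotic series of $\rho_n$: if $(d_k)_{k\ge0}$ is a sequence of real numbers such that $\rho_n\sim-\frac{1}{2n^{3/2}}\sum_{k\ge0}d_kn^{-k}$ as $n\to\infty$ in the sense of Poincaré (that is, $-2n^{3/2}\rho_n=\sum_{k=0}^{m-1}d_kn^{-k}+O(n^{-m})$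 for each fixed $m>0$), then $k!\,2^{6k}d_k\in\mathbb Z$ for all $k\ge0$. -/

import Mathlib

open scoped Nat

noncomputable section

namespace HadamardExp

/-! ### The two functions and their Maclaurin coefficients -/

/-- The exponential integral `E₁(x) = ∫_x^∞ e^{-t} / t dt` (for `x > 0`). -/
def E₁ (x : ℝ) : ℝ := ∫ t in Set.Ioi x, Real.exp (-t) / t

/-- `f₀(z) = e^{z/(1-z)}`, on the real points of the unit disk. -/
def f₀ (z : ℝ) : ℝ := Real.exp (z / (1 - z))

/-- `f₁(z) = e^x E₁(x)` with `x = 1/(1-z)`, on the real points of the unit disk. -/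
def f₁ (z : ℝ) : ℝ := Real.exp (1 / (1 - z)) * E₁ (1 / (1 - z))

/-- The Maclaurin coefficient `[zⁿ] f(z) = f⁽ⁿ⁾(0) / n!`. -/
def maclaurinCoeff (f : ℝ → ℝ) (n : ℕ) : ℝ := iteratedDeriv n f 0 / n !

/-- `aₙ = [zⁿ] f₀(z)`. -/
def a (n : ℕ) : ℝ := maclaurinCoeff f₀ n

/-- `bₙ = [zⁿ] f₁(z)`. -/
def b (n : ℕ) : ℝ := maclaurinCoeff f₁ n

/-- `ρₙ = aₙ bₙ`, the Maclaurin coefficients of the Hadamard product of `f₀` and `f₁`. -/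
def ρ (n : ℕ) : ℝ := a n * b n

/-! ### Asymptotic series -/

/-- `f(n) ∼ ∑_{k ≥ 0} dₖ n^{-k}` as `n → ∞`, in the sense of Poincaré: for every fixed `m > 0`,
`f(n) = ∑_{k < m} dₖ n^{-k} + O(n^{-m})`. -/
def IsAsymptoticSeries (f : ℕ → ℝ) (d : ℕ → ℝ) : Prop :=
  ∀ m : ℕ, 0 < m →
    (fun n : ℕ => f n - ∑ k ∈ Finset.range m, d k / (n : ℝ) ^ k)
      =O[Filter.atTop] (fun n : ℕ => 1 / (n : ℝ) ^ m)

/-! ### The coefficients of the expansions -/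

/-- The power series `μ(h) = h⁻¹ - (e^h - 1)⁻¹ - 1/2`, written through
`h / (e^h - 1) = ∑ Bₙ hⁿ / n!`; see `X_mul_exp_sub_one_mul_μ`. -/
def μ : PowerSeries ℚ :=
  PowerSeries.mk fun n => -(bernoulli (n + 1) / (n + 1)!) - if n = 0 then 1 / 2 else 0

/-- The defining equation `μ(h) = h⁻¹ - (e^h - 1)⁻¹ - 1/2`, multiplied by `h (e^h - 1)`. -/
theorem X_mul_exp_sub_one_mul_μ :
    PowerSeries.X * (PowerSeries.exp ℚ - 1) * μ =
      (PowerSeries.exp ℚ - 1) - PowerSeries.X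
        - PowerSeries.C (1 / 2 : ℚ) * PowerSeries.X * (PowerSeries.exp ℚ - 1) := by
  have h1 : PowerSeries.X * μ =
      1 - bernoulliPowerSeries ℚ - PowerSeries.C (1 / 2 : ℚ) * PowerSeries.X := by
    ext n
    cases n with
    | zero => simp [bernoulliPowerSeries]
    | succ n =>
      rw [mul_comm PowerSeries.X μ, PowerSeries.coeff_succ_mul_X]
      simp [μ, bernoulliPowerSeries, PowerSeries.coeff_one, PowerSeries.coeff_C]
  have h2 := bernoulliPowerSeries_mul_exp_sub_one ℚ
  linear_combination (PowerSeries.exp ℚ - 1) * h1 - h2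

/-- The power series `exp(μ(h))`. -/
def expμ : PowerSeries ℚ := (PowerSeries.exp ℚ).subst μ

/-- `μ` has no constant term, so that the substitution in `expμ` is meaningful. -/
theorem hasSubst_μ : PowerSeries.HasSubst μ := by
  apply PowerSeries.HasSubst.of_constantCoeff_zero'
  rw [← PowerSeries.coeff_zero_eq_constantCoeff_apply]
  norm_num [μ, bernoulli_one]

/-- `c_m = (-1)^m ∑_{j=0}^m [h^{m-j}] exp(μ(h)) · (m - 2j + 3/2)_{2j} / (4^j j!)`, where
`(x)_n = x (x+1) ⋯ (x+n-1)`. -/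
def c (m : ℕ) : ℚ :=
  (-1) ^ m * ∑ j ∈ Finset.range (m + 1),
    PowerSeries.coeff (m - j) expμ *
      ((ascPochhammer ℚ (2 * j)).eval ((m : ℚ) - 2 * (j : ℚ) + 3 / 2) / (4 ^ j * (j ! : ℚ)))

/-- `d_k = ∑_{j=0}^{2k} (-1)^j c_j c_{2k-j}`. -/
def d (k : ℕ) : ℚ := ∑ j ∈ Finset.range (2 * k + 1), (-1) ^ j * c j * c (2 * k - j)

/-- `r_k = 2^{6k} d_k`. -/
def r (k : ℕ) : ℚ := 2 ^ (6 * k) * d k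

end HadamardExp

end

/-! The sequences `a` and `b` eventually solve (n+1) x_{n+1} = (2n+1) x_n - (n-1) x_{n-1}, so `ρ`
satisfies a recurrence of third order. Inserting n^{-3/2} P(1/n) turns it into `recurrenceSeries P =
0`. Its power series solutions form at most a line: at order N the leading coefficient is multiplied
by 8N, so P is determined by its constant term (`eq_zero_of_recurrenceSeries_eq_zero`). Three series
are compared on this line.

The series ∑ d_k u^k. One has b_n = -√e ∫_0^∞ exp(-nh - 1/h + μ(h)) dh for n ≥ 1. Expanding exp(μ)
and inserting the asymptotic series of the Bessel functions K_ν gives, up to an elementary factor, a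
formal solution L(t) with t = n^{-1/2} and coefficients (-1)^m c_m. Then L(-t) belongs to a second
formal solution, and L(t) L(-t) = ∑ d_k t^{2k}. This motivates a purely formal proof of
`recurrenceSeries_mk_d`.

A series given by a Borel transform. With G = e^{-tanh 4X} (sinh(8X)/(8X))^{-1/2} B(sinh 8X), where
B is the asymptotic series of I_1, put d'_k = (1/2)_k 16^{-k} [X^k] G. Under this transform the
shift n → n + i becomes multiplication by e^{-16iX} and powers of n become Euler operators. The
recurrence becomes a linear differential equation, which G satisfies (`borelSeries_ode`). Both
constant terms are 1, hence d'_k = d_k. Since k! 4^k (1/2)_k = (2k)!, it follows that k! 2^{6k} d_k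
= (2k)! [X^k] G, and this is an integer by inspection of the three factors of G.

Any asymptotic series of -2 n^{3/2} ρ_n. Expansions are unique and respect sums, products and
shifts, so it lies on the same line. The Casoratian of a and b forces its constant term to have
square 1 (`coeff_zero_sq_of_hasExpansion`). Its coefficients are therefore ±d_k with one common
sign, which suffices for integrality. -/

noncomputable section
namespace HadamardExp

open PowerSeries Finset

/-! ### Formal shifts n → n + i and uniqueness for the formal recurrence -/

section Shift

variable {K : Type*} [Field K]

/-- The series in `u = 1/n` of `n^α F(n + i)`, where `F(n) = n^{-α} P(1/n)`. -/
def shift (α i : K) (P : PowerSeries K) : PowerSeries K :=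
  PowerSeries.mk fun N => ∑ p ∈ antidiagonal N,
    coeff p.1 P * ((-i) ^ p.2 * (ascPochhammer K p.2).eval ((p.1 : K) + α) / (p.2 ! : K))

theorem coeff_shift (α i : K) (P : PowerSeries K) (N : ℕ) :
    coeff N (shift α i P) = ∑ p ∈ antidiagonal N,
      coeff p.1 P * ((-i) ^ p.2 * (ascPochhammer K p.2).eval ((p.1 : K) + α) / (p.2 ! : K)) :=
  coeff_mk _ _

theorem shift_sub (α i : K) (P Q : PowerSeries K) :
    shift α i (P - Q) = shift α i P - shift α i Q := by
  ext N
  simp only [coeff_shift, map_sub, sub_mul, sum_sub_distrib]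

theorem shift_C_mul (α i z : K) (P : PowerSeries K) :
    shift α i (C z * P) = C z * shift α i P := by
  ext N
  simp only [coeff_shift, coeff_C_mul, mul_sum, mul_assoc]

theorem shift_X_mul (α i : K) (P : PowerSeries K) :
    shift α i (X * P) = X * shift (α + 1) i P := by
  ext N
  cases N with
  | zero => simp [coeff_shift]
  | succ N =>
    rw [coeff_succ_X_mul, coeff_shift, coeff_shift, Finset.Nat.sum_antidiagonal_succ]
    simp only [coeff_succ_X_mul, coeff_zero_X_mul, zero_mul, zero_add]
    refine sum_congr rfl fun p _ => ?_
    push_cast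
    rw [show ((p.1 : K) + 1 + α) = p.1 + (α + 1) by ring]

theorem shift_X_pow_mul (α i : K) (k : ℕ) (P : PowerSeries K) :
    shift α i (X ^ k * P) = X ^ k * shift (α + k) i P := by
  induction k generalizing α with
  | zero => simp
  | succ k ih =>
    rw [pow_succ', mul_assoc, shift_X_mul, ih, ← mul_assoc]
    push_cast
    rw [show α + 1 + (k : K) = α + (k + 1) by ring]

theorem coeff_zero_shift (α i : K) (P : PowerSeries K) :
    coeff 0 (shift α i P) = coeff 0 P := by
  simp [coeff_shift]

theorem coeff_one_shift (α i : K) (P : PowerSeries K) :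
    coeff 1 (shift α i P) = coeff 1 P - i * α * coeff 0 P := by
  simp [coeff_shift, Finset.Nat.antidiagonal_succ]
  ring

theorem coeff_two_shift [CharZero K] (α i : K) (P : PowerSeries K) :
    coeff 2 (shift α i P) = coeff 2 P - i * (α + 1) * coeff 1 P
      + i ^ 2 * α * (α + 1) / 2 * coeff 0 P := by
  simp [coeff_shift, Finset.Nat.antidiagonal_succ, ascPochhammer_succ_right]
  ring

theorem shift_zero (α : K) (P : PowerSeries K) : shift α 0 P = P := by
  ext N
  rw [coeff_shift, sum_eq_single (N, 0)]
  · simp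
  · rintro ⟨k, r⟩ h hne
    have hr : r ≠ 0 := by
      rintro rfl
      apply hne
      simpa using h
    simp [hr]
  · simp

/-- Multiplying by 1 + i/n = (n+i)/n raises the exponent of n + i by one and lowers that of n. -/
theorem one_add_mul_shift [CharZero K] (α i : K) (P : PowerSeries K) :
    (1 + C i * X) * shift α i P = shift (α - 1) i P := by
  ext N
  rw [add_mul, one_mul, map_add, mul_assoc, coeff_C_mul]
  cases N with
  | zero => simp [coeff_shift]
  | succ N =>
    rw [coeff_succ_X_mul, coeff_shift, coeff_shift, coeff_shift, mul_sum,
      Finset.Nat.sum_antidiagonal_succ', Finset.Nat.sum_antidiagonal_succ', add_assoc,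
      ← sum_add_distrib]
    congr 1
    · simp
    · refine sum_congr rfl fun p _ => ?_
      have h1 : (ascPochhammer K (p.2 + 1)).eval ((p.1 : K) + α) =
          (ascPochhammer K p.2).eval ((p.1 : K) + α) * (p.1 + α + p.2) := by
        rw [ascPochhammer_succ_right]; simp
      have h2 : (ascPochhammer K (p.2 + 1)).eval ((p.1 : K) + (α - 1)) =
          (p.1 + (α - 1)) * (ascPochhammer K p.2).eval ((p.1 : K) + α) := by
        rw [ascPochhammer_succ_left]
        simp only [Polynomial.eval_mul, Polynomial.eval_X, Polynomial.eval_comp,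
          Polynomial.eval_add, Polynomial.eval_one]
        rw [show (p.1 : K) + (α - 1) + 1 = p.1 + α by ring]
      rw [h1, h2, Nat.factorial_succ]
      have h3 : (p.2 ! : K) ≠ 0 := by exact_mod_cast p.2.factorial_ne_zero
      have h4 : (p.2 : K) + 1 ≠ 0 := by exact_mod_cast p.2.succ_ne_zero
      push_cast
      field_simp
      ring

theorem map_shift {L : Type*} [Field L] (f : K →+* L) (α i : K) (P : PowerSeries K) :
    PowerSeries.map f (shift α i P) = shift (f α) (f i) (PowerSeries.map f P) := by
  ext N
  simp only [coeff_map, coeff_shift, map_sum, map_mul, map_div₀, map_pow, map_neg, map_natCast]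
  refine sum_congr rfl fun p _ => ?_
  rw [← ascPochhammer_map f, Polynomial.eval_map, ← map_natCast f, ← map_natCast f p.1, ← map_add,
    Polynomial.eval₂_hom]

/-- The left side of the third order recurrence for the product of two solutions of
`(n + 1) x_{n+1} - (2n + 1) x_n + (n - 1) x_{n-1} = 0`, as a series in `u = 1/n`, for a product
of the form `n^{-3/2} P(1/n)`. -/
def recurrenceSeries (P : PowerSeries K) : PowerSeries K :=
  (2 - X) * (1 + X) ^ 2 * shift (3 / 2) 1 P
    + (2 + X) * (-3 - X + X ^ 2) * P
    + (1 - X) * (2 - X) * (3 + X - X ^ 2) * shift (3 / 2) (-1) P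
    - (1 - X) * (1 - 2 * X) ^ 2 * (2 + X) * shift (3 / 2) (-2) P

theorem recurrenceSeries_sub (P Q : PowerSeries K) :
    recurrenceSeries (P - Q) = recurrenceSeries P - recurrenceSeries Q := by
  simp only [recurrenceSeries, shift_sub]
  ring

theorem recurrenceSeries_C_mul (z : K) (P : PowerSeries K) :
    recurrenceSeries (C z * P) = C z * recurrenceSeries P := by
  simp only [recurrenceSeries, shift_C_mul]
  ring

theorem map_recurrenceSeries {L : Type*} [Field L] (f : K →+* L) (P : PowerSeries K) :
    PowerSeries.map f (recurrenceSeries P) = recurrenceSeries (PowerSeries.map f P) := by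
  have h (k : ℕ) [k.AtLeastTwo] :
      PowerSeries.map f (OfNat.ofNat k) = OfNat.ofNat k := map_ofNat _ _
  have h' (k : ℕ) [k.AtLeastTwo] : f (OfNat.ofNat k) = OfNat.ofNat k := map_ofNat _ _
  simp [recurrenceSeries, map_shift, h, h']

/-- All terms of order X^3 are collected in the last summand, because only the coefficients of
degree at most 2 are inspected. -/
theorem recurrence_combination (S₁ S₂ S₃ S₄ : PowerSeries K) :
    (2 - X) * (1 + X) ^ 2 * S₁ + (2 + X) * (-3 - X + X ^ 2) * S₂
      + (1 - X) * (2 - X) * (3 + X - X ^ 2) * S₃ - (1 - X) * (1 - 2 * X) ^ 2 * (2 + X) * S₄ =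
    C 2 * S₁ + C 3 * (X * S₁) + C (-6) * S₂ + C (-5) * (X * S₂) + X * (X * S₂)
      + C 6 * S₃ + C (-7) * (X * S₃) + C (-2) * (X * (X * S₃))
      + C (-2) * S₄ + C 9 * (X * S₄) + C (-11) * (X * (X * S₄))
      + X * (X * (X * (S₂ - S₁ + C 4 * S₃ - X * S₃ + C 4 * (X * S₄)))) := by
  have h (k : ℕ) [k.AtLeastTwo] :
      (C (OfNat.ofNat k : K) : PowerSeries K) = OfNat.ofNat k := map_ofNat _ _
  simp only [map_neg, h]
  ring

theorem eq_zero_of_recurrenceSeries_eq_zero [CharZero K] {P : PowerSeries K}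
    (h : recurrenceSeries P = 0) (h0 : coeff 0 P = 0) : P = 0 := by
  ext N
  induction N using Nat.strong_induction_on with
  | _ N ih =>
    rcases Nat.eq_zero_or_pos N with rfl | hN
    · simpa using h0
    obtain ⟨Q, rfl⟩ : X ^ N ∣ P := X_pow_dvd_iff.2 fun k hk => by simpa using ih k hk
    have hQ : X ^ N * ((2 - X) * (1 + X) ^ 2 * shift (3 / 2 + (N : K)) 1 Q
        + (2 + X) * (-3 - X + X ^ 2) * Q
        + (1 - X) * (2 - X) * (3 + X - X ^ 2) * shift (3 / 2 + (N : K)) (-1) Q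
        - (1 - X) * (1 - 2 * X) ^ 2 * (2 + X) * shift (3 / 2 + (N : K)) (-2) Q) = 0 := by
      rw [← h, recurrenceSeries]
      simp only [shift_X_pow_mul]
      ring
    have hQ' := (mul_eq_zero.1 hQ).resolve_left (pow_ne_zero _ X_ne_zero)
    rw [recurrence_combination] at hQ'
    -- Degree 2 is the first to give a condition; in it the coefficients 1 and 2 of Q cancel and 8N
    -- times the constant term remains.
    have h2 := congrArg (coeff (0 + 1 + 1)) hQ'
    simp only [map_add, coeff_C_mul, coeff_succ_X_mul, coeff_zero_X_mul, map_zero,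
      coeff_zero_shift, zero_add, coeff_one_shift] at h2
    norm_num only [coeff_two_shift] at h2
    have h3 : (8 * (N : K)) * coeff 0 Q = 0 := by linear_combination h2
    have h4 : (N : K) ≠ 0 := by exact_mod_cast hN.ne'
    have h5 : coeff 0 Q = 0 := by simpa [h4] using h3
    simpa [coeff_X_pow_mul'] using h5

end Shift

end HadamardExp
end

noncomputable section
namespace HadamardExp

open PowerSeries Finset

/-! ### Exponentials of formal derivations -/

section Flow

variable {K : Type*} [Field K]

/-- The formal sum `∑_r x_r`, for series `x_r` divisible by `X^r`. -/
def formalSum (x : ℕ → PowerSeries K) : PowerSeries K :=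
  PowerSeries.mk fun N => ∑ r ∈ range (N + 1), coeff N (x r)

theorem coeff_formalSum {x : ℕ → PowerSeries K} (hx : ∀ r, X ^ r ∣ x r) {N M : ℕ} (h : N ≤ M) :
    coeff N (formalSum x) = coeff N (∑ r ∈ range (M + 1), x r) := by
  rw [formalSum, coeff_mk, map_sum]
  refine sum_subset (range_mono (by omega)) fun r _ hr => ?_
  exact X_pow_dvd_iff.1 (hx r) N (by simpa using hr)

theorem formalSum_mul {x y : ℕ → PowerSeries K} (hx : ∀ r, X ^ r ∣ x r) (hy : ∀ r, X ^ r ∣ y r) :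
    formalSum x * formalSum y = formalSum fun m => ∑ p ∈ antidiagonal m, x p.1 * y p.2 := by
  ext N
  have h1 : coeff N (formalSum x * formalSum y) =
      coeff N ((∑ r ∈ range (N + 1), x r) * ∑ r ∈ range (N + 1), y r) := by
    rw [coeff_mul, coeff_mul]
    refine sum_congr rfl fun p hp => ?_
    have hp' := HasAntidiagonal.mem_antidiagonal.1 hp
    rw [coeff_formalSum hx (show p.1 ≤ N by omega), coeff_formalSum hy (show p.2 ≤ N by omega)]
  rw [h1, sum_mul_sum, ← sum_product', map_sum, formalSum, coeff_mk]
  simp only [map_sum]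
  rw [← sum_filter_add_sum_filter_not _ (fun p : ℕ × ℕ => p.1 + p.2 ≤ N)]
  rw [sum_eq_zero (s := filter (fun p : ℕ × ℕ => ¬ p.1 + p.2 ≤ N) _), add_zero]
  · rw [← sum_fiberwise_of_maps_to (g := fun p : ℕ × ℕ => p.1 + p.2) (t := range (N + 1))]
    · refine sum_congr rfl fun m hm => sum_congr ?_ fun _ _ => rfl
      ext p
      simp only [mem_filter, mem_product, mem_range, HasAntidiagonal.mem_antidiagonal] at hm ⊢
      omega
    · intro p hp
      simp only [mem_filter, mem_product, mem_range] at hp ⊢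
      omega
  · intro p hp
    have h2 : X ^ (p.1 + p.2) ∣ x p.1 * y p.2 := by
      rw [pow_add]
      exact mul_dvd_mul (hx _) (hy _)
    refine X_pow_dvd_iff.1 h2 N ?_
    simpa using (mem_filter.1 hp).2

/-- The operator of `exp(-iT)`, applied to a sequence `x_r = T^r x_0`. -/
def flow (i : K) (x : ℕ → PowerSeries K) : PowerSeries K :=
  formalSum fun r => C ((-i) ^ r / (r ! : K)) * x r

theorem coeff_flow (i : K) (x : ℕ → PowerSeries K) (N : ℕ) :
    coeff N (flow i x) = ∑ r ∈ range (N + 1), (-i) ^ r / (r ! : K) * coeff N (x r) := by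
  simp [flow, formalSum]

/-- The exponential of a derivation is multiplicative; `hz` is the iterated Leibniz rule. -/
theorem flow_mul [CharZero K] (i : K) {x y z : ℕ → PowerSeries K}
    (hx : ∀ r, X ^ r ∣ x r) (hy : ∀ r, X ^ r ∣ y r)
    (hz : ∀ m, z m = ∑ p ∈ antidiagonal m, m.choose p.1 • (x p.1 * y p.2)) :
    flow i x * flow i y = flow i z := by
  rw [flow, flow, formalSum_mul (fun r => (hx r).mul_left _) (fun r => (hy r).mul_left _), flow]
  congr 1
  ext1 m
  rw [hz, mul_sum]
  refine sum_congr rfl fun p hp => ?_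
  have hp' := HasAntidiagonal.mem_antidiagonal.1 hp
  rw [mul_mul_mul_comm, ← map_mul, nsmul_eq_mul, ← map_natCast (C (R := K)),
    ← mul_assoc (C _) (C _), ← map_mul]
  congr 2
  have h : (m.choose p.1 * p.1 ! * p.2 ! : K) = m ! := by
    have := Nat.choose_mul_factorial_mul_factorial (show p.1 ≤ m by omega)
    rw [show m - p.1 = p.2 by omega] at this
    exact_mod_cast this
  have h1 : (p.1 ! : K) ≠ 0 := by exact_mod_cast p.1.factorial_ne_zero
  have h2 : (p.2 ! : K) ≠ 0 := by exact_mod_cast p.2.factorial_ne_zero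
  have h3 : (m ! : K) ≠ 0 := by exact_mod_cast m.factorial_ne_zero
  rw [← hp', pow_add] at *
  field_simp
  rw [← h]
  ring

/-- T itself need not be a derivation: the two factors may be advanced by operators other than T, as
happens when their exponential prefactors cancel in the product. -/
theorem leibniz_iterate (T : PowerSeries K →+ PowerSeries K) (x y z : ℕ → PowerSeries K)
    (hT : ∀ r s, T (x r * y s) = x (r + 1) * y s + x r * y (s + 1))
    (h0 : z 0 = x 0 * y 0) (hz : ∀ m, z (m + 1) = T (z m)) (m : ℕ) :
    z m = ∑ p ∈ antidiagonal m, m.choose p.1 • (x p.1 * y p.2) := by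
  induction m with
  | zero => simp [h0]
  | succ m ih =>
    rw [hz, ih, sum_antidiagonal_choose_succ_nsmul (fun i j => x i * y j) m, map_sum,
      ← sum_add_distrib]
    refine sum_congr rfl fun p hp => ?_
    rw [map_nsmul, hT, smul_add, add_comm,
      Nat.choose_symm_of_eq_add (HasAntidiagonal.mem_antidiagonal.1 hp).symm]

/-- The negative of `n`-differentiation of `n^{-α} P(1/n)`. -/
def diffOp (α : K) (P : PowerSeries K) : PowerSeries K :=
  C α * (X * P) + X ^ 2 * d⁄dX K P

theorem coeff_succ_diffOp (α : K) (P : PowerSeries K) (k : ℕ) :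
    coeff (k + 1) (diffOp α P) = (k + α) * coeff k P := by
  rw [diffOp, map_add, coeff_C_mul, coeff_succ_X_mul, pow_two, mul_assoc, coeff_succ_X_mul]
  cases k with
  | zero => simp
  | succ k =>
    rw [coeff_succ_X_mul, coeff_derivative]
    push_cast
    ring

theorem coeff_zero_diffOp (α : K) (P : PowerSeries K) : coeff 0 (diffOp α P) = 0 := by
  simp [diffOp]

theorem coeff_iterate_diffOp (α : K) (P : PowerSeries K) (m k : ℕ) :
    coeff (k + m) ((diffOp α)^[m] P) = (ascPochhammer K m).eval ((k : K) + α) * coeff k P := by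
  induction m generalizing P with
  | zero => simp
  | succ m ih =>
    rw [Function.iterate_succ_apply', ← add_assoc, coeff_succ_diffOp, ih, ascPochhammer_succ_right]
    simp
    ring

theorem coeff_iterate_diffOp_of_lt (α : K) (P : PowerSeries K) {m N : ℕ} (h : N < m) :
    coeff N ((diffOp α)^[m] P) = 0 := by
  induction m generalizing N with
  | zero => omega
  | succ m ih =>
    rw [Function.iterate_succ_apply']
    cases N with
    | zero => exact coeff_zero_diffOp _ _
    | succ N => rw [coeff_succ_diffOp, ih (by omega), mul_zero]

/-- Taylor's formula: exp(i d/dn) is the shift by i. The expansion by 2 passes from u = 1/n to t =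
n^{-1/2}. -/
theorem flow_expand (i α : K) (P : PowerSeries K) :
    flow i (fun m => expand 2 two_ne_zero ((diffOp α)^[m] P)) =
      expand 2 two_ne_zero (shift α i P) := by
  ext N
  rw [coeff_flow]
  by_cases h : 2 ∣ N
  · obtain ⟨M, rfl⟩ := h
    simp only [coeff_expand_mul]
    rw [coeff_shift, ← Finset.Nat.sum_antidiagonal_swap,
      Finset.Nat.sum_antidiagonal_eq_sum_range_succ_mk]
    refine (sum_subset (range_mono (by omega)) fun r _ hr => ?_).symm.trans
      (sum_congr rfl fun r hr => ?_)
    · rw [coeff_iterate_diffOp_of_lt _ _ (by simpa using hr), mul_zero]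
    · have hr' : r ≤ M := by simpa using hr
      obtain ⟨k, rfl⟩ := Nat.exists_eq_add_of_le' hr'
      rw [coeff_iterate_diffOp]
      simp only [Nat.add_sub_cancel, Prod.swap_prod_mk]
      ring
  · simp [coeff_expand_of_not_dvd 2 two_ne_zero _ h]

end Flow

/-! ### The formal Laplace transform with kernel e^{-nh-1/h} -/

section Laplace

/-- The coefficients of the asymptotic series of the Bessel function `K_ν`. -/
def besselCoeff (j : ℕ) (ν : ℚ) : ℚ :=
  (ascPochhammer ℚ (2 * j)).eval (ν - j + 1 / 2) / (4 ^ j * (j ! : ℚ))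

theorem besselCoeff_zero (ν : ℚ) : besselCoeff 0 ν = 1 := by
  simp [besselCoeff]

theorem ascPochhammer_eval_add_two (n : ℕ) (x : ℚ) :
    (ascPochhammer ℚ (n + 2)).eval x =
      x * (ascPochhammer ℚ n).eval (x + 1) * (x + n + 1) := by
  rw [ascPochhammer_succ_left]
  simp only [Polynomial.eval_mul, Polynomial.eval_X, Polynomial.eval_comp, Polynomial.eval_add,
    Polynomial.eval_one]
  rw [ascPochhammer_succ_right]
  simp
  ring

theorem ascPochhammer_eval_add_two' (n : ℕ) (x : ℚ) :
    (ascPochhammer ℚ (n + 2)).eval x =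
      (ascPochhammer ℚ n).eval x * (x + n) * (x + n + 1) := by
  rw [ascPochhammer_succ_right, ascPochhammer_succ_right]
  simp only [Polynomial.eval_mul, Polynomial.eval_X, Polynomial.eval_add, Polynomial.eval_natCast]
  push_cast
  ring

theorem ascPochhammer_eval_add_two'' (n : ℕ) (x : ℚ) :
    (ascPochhammer ℚ (n + 2)).eval x =
      x * (x + 1) * (ascPochhammer ℚ n).eval (x + 2) := by
  rw [ascPochhammer_succ_left]
  simp only [Polynomial.eval_mul, Polynomial.eval_X, Polynomial.eval_comp, Polynomial.eval_add,
    Polynomial.eval_one]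
  rw [ascPochhammer_succ_left]
  simp only [Polynomial.eval_mul, Polynomial.eval_X, Polynomial.eval_comp, Polynomial.eval_add,
    Polynomial.eval_one]
  rw [show x + 1 + 1 = x + 2 by ring]
  ring

/-- Coefficient form of K_{ν+1}(x) = (ν/x) K_ν(x) - K_ν'(x), with x = 2/t. -/
theorem besselCoeff_succ_add_one (j : ℕ) (ν : ℚ) :
    besselCoeff (j + 1) (ν + 1) =
      besselCoeff (j + 1) ν + ((ν + j + 1) / 2 - 1 / 4) * besselCoeff j ν := by
  simp only [besselCoeff, mul_add, mul_one, Nat.factorial_succ]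
  rw [ascPochhammer_eval_add_two' _ (ν + 1 - _ + _), ascPochhammer_eval_add_two]
  push_cast
  rw [show ν + 1 - ((j : ℚ) + 1) + 1 / 2 = ν - j + 1 / 2 by ring,
    show ν - ((j : ℚ) + 1) + 1 / 2 + 1 = ν - j + 1 / 2 by ring]
  have h1 : (j ! : ℚ) ≠ 0 := by exact_mod_cast j.factorial_ne_zero
  have h2 : (j : ℚ) + 1 ≠ 0 := by exact_mod_cast j.succ_ne_zero
  field_simp
  ring

/-- Coefficient form of K_{ν+1}(x) - K_{ν-1}(x) = (2ν/x) K_ν(x), with x = 2/t. -/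
theorem besselCoeff_succ_add_two (j : ℕ) (ν : ℚ) :
    besselCoeff (j + 1) (ν + 1) = besselCoeff (j + 1) (ν - 1) + ν * besselCoeff j ν := by
  simp only [besselCoeff, mul_add, mul_one, Nat.factorial_succ]
  rw [ascPochhammer_eval_add_two' _ (ν + 1 - _ + _), ascPochhammer_eval_add_two'']
  push_cast
  rw [show ν + 1 - ((j : ℚ) + 1) + 1 / 2 = ν - j + 1 / 2 by ring,
    show ν - 1 - ((j : ℚ) + 1) + 1 / 2 + 2 = ν - j + 1 / 2 by ring]
  have h1 : (j ! : ℚ) ≠ 0 := by exact_mod_cast j.factorial_ne_zero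
  have h2 : (j : ℚ) + 1 ≠ 0 := by exact_mod_cast j.succ_ne_zero
  field_simp
  ring

/-- The asymptotic series in `t = n^{-1/2}` of `∫_0^∞ e^{-nh-1/h} E(h) dh`, up to the factor
`√π e^{-2/t} t^{3/2}`. -/
def laplace : PowerSeries ℚ →ₗ[ℚ] PowerSeries ℚ where
  toFun E := PowerSeries.mk fun m => ∑ p ∈ antidiagonal m,
    coeff p.1 E * besselCoeff p.2 ((p.1 : ℚ) + 1)
  map_add' E F := by
    ext m
    simp [add_mul, sum_add_distrib]
  map_smul' z E := by
    ext m
    simp [mul_sum, mul_assoc]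

theorem coeff_laplace (E : PowerSeries ℚ) (m : ℕ) :
    coeff m (laplace E) = ∑ p ∈ antidiagonal m,
      coeff p.1 E * besselCoeff p.2 ((p.1 : ℚ) + 1) := by
  simp [laplace]

theorem laplace_C_mul (z : ℚ) (E : PowerSeries ℚ) : laplace (C z * E) = C z * laplace E := by
  rw [← smul_eq_C_mul, map_smul, smul_eq_C_mul]

/-- A factor h under the integral is -d/dn = (t^3/2) d/dt; the first two terms come from the
prefactor e^{-2/t} t^{3/2}. -/
theorem laplace_X_mul (E : PowerSeries ℚ) :
    laplace (X * E) = X * laplace E + C (3 / 4) * (X ^ 2 * laplace E)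
      + C (1 / 2) * (X ^ 3 * d⁄dX ℚ (laplace E)) := by
  ext m
  simp only [map_add, coeff_C_mul, pow_succ, pow_zero, one_mul, mul_assoc]
  cases m with
  | zero => simp [coeff_laplace]
  | succ m =>
    rw [coeff_laplace, Finset.Nat.sum_antidiagonal_succ]
    simp only [coeff_succ_X_mul, coeff_zero_X_mul, zero_mul, zero_add]
    cases m with
    | zero => simp [coeff_laplace, besselCoeff_zero]
    | succ m =>
      have h : coeff (m + 1) (X * (X * d⁄dX ℚ (laplace E))) = m * coeff m (laplace E) := by
        rw [coeff_succ_X_mul]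
        cases m with
        | zero => simp
        | succ m =>
          rw [coeff_succ_X_mul, coeff_derivative]
          push_cast
          ring
      rw [h, coeff_succ_X_mul, coeff_laplace, coeff_laplace, Finset.Nat.sum_antidiagonal_succ',
        Finset.Nat.sum_antidiagonal_succ', mul_sum, mul_sum, mul_sum]
      simp only [add_assoc, ← sum_add_distrib, besselCoeff_zero]
      congr 1
      refine sum_congr rfl fun p hp => ?_
      have hp' : (p.1 : ℚ) + p.2 = m := by exact_mod_cast HasAntidiagonal.mem_antidiagonal.1 hp
      push_cast
      rw [besselCoeff_succ_add_one, ← hp']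
      ring

/-- Integration by parts: the derivative of e^{-nh-1/h} h^2 H has integral zero, and n = t^{-2}. -/
theorem laplace_X_sq_mul (H : PowerSeries ℚ) :
    laplace (X ^ 2 * H) = X ^ 2 * laplace (H + d⁄dX ℚ (X ^ 2 * H)) := by
  have h0 : d⁄dX ℚ (X ^ 2 * H) = X * (2 * H + X * d⁄dX ℚ H) := by
    rw [Derivation.leibniz, derivative_pow, derivative_X]
    simp
    ring
  ext m
  rw [h0]
  simp only [pow_two, mul_assoc]
  rcases m with _ | _ | m
  · simp [coeff_laplace]
  · simp [coeff_laplace, Finset.Nat.antidiagonal_succ]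
  · rw [coeff_laplace, Finset.Nat.sum_antidiagonal_succ, Finset.Nat.sum_antidiagonal_succ]
    simp only [coeff_succ_X_mul, coeff_zero_X_mul, zero_mul, zero_add]
    rw [map_add, map_add, coeff_laplace, coeff_laplace]
    cases m with
    | zero => simp [besselCoeff_zero]
    | succ m =>
      rw [Finset.Nat.sum_antidiagonal_succ', Finset.Nat.sum_antidiagonal_succ',
        Finset.Nat.sum_antidiagonal_succ (n := m)]
      simp only [coeff_succ_X_mul, coeff_zero_X_mul, zero_mul, zero_add, besselCoeff_zero]
      rw [add_assoc, ← sum_add_distrib]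
      congr 1
      refine sum_congr rfl fun p hp => ?_
      have h : coeff p.1 (2 * H + X * d⁄dX ℚ H) = (p.1 + 2) * coeff p.1 H := by
        rw [map_add, two_mul, map_add]
        cases p.1 with
        | zero => simp; ring
        | succ k =>
          rw [coeff_succ_X_mul, coeff_derivative]
          push_cast
          ring
      rw [h]
      push_cast
      have h1 := besselCoeff_succ_add_two p.2 ((p.1 : ℚ) + 2)
      rw [show (p.1 : ℚ) + 1 + 1 + 1 = p.1 + 2 + 1 by ring, h1,
        show (p.1 : ℚ) + 2 - 1 = p.1 + 1 by ring, show (p.1 : ℚ) + 1 + 1 = p.1 + 2 by ring]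
      ring

theorem X_pow_dvd_laplace (r : ℕ) (E : PowerSeries ℚ) : X ^ r ∣ laplace (X ^ r * E) := by
  refine X_pow_dvd_iff.2 fun m hm => ?_
  rw [coeff_laplace]
  refine sum_eq_zero fun p hp => ?_
  have := HasAntidiagonal.mem_antidiagonal.1 hp
  rw [coeff_X_pow_mul', if_neg (by omega), zero_mul]

/-- A factor e^{-ih} shifts n by i; expanded, it is the exponential of -i times multiplication by h.
-/
theorem laplace_exp_mul (i : ℚ) (E : PowerSeries ℚ) :
    laplace (rescale (-i) (exp ℚ) * E) = flow i fun r => laplace (X ^ r * E) := by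
  ext N
  rw [coeff_flow, coeff_laplace]
  simp only [coeff_laplace, mul_sum]
  rw [sum_comm]
  refine sum_congr rfl fun p hp => ?_
  have hp' := HasAntidiagonal.mem_antidiagonal.1 hp
  rw [coeff_mul, Finset.Nat.sum_antidiagonal_eq_sum_range_succ_mk, sum_mul]
  refine (sum_congr rfl fun r hr => ?_).trans
    (sum_subset (range_mono (show p.1 + 1 ≤ N + 1 by omega)) fun r _ hr => ?_)
  · rw [coeff_X_pow_mul', if_pos (by simpa using hr), coeff_rescale, coeff_exp]
    simp
    ring
  · rw [coeff_X_pow_mul', if_neg (by simpa using hr)]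
    simp

end Laplace

end HadamardExp
end

noncomputable section
namespace HadamardExp

open PowerSeries Finset

/-! ### The series of the d_k solves the formal recurrence -/

section FormalSolution

theorem derivative_rescale_exp (z : ℚ) :
    d⁄dX ℚ (rescale z (exp ℚ)) = C z * rescale z (exp ℚ) := by
  ext n
  rw [coeff_derivative, coeff_C_mul, coeff_rescale, coeff_rescale, coeff_exp, coeff_exp,
    Nat.factorial_succ]
  have h1 : (n ! : ℚ) ≠ 0 := by exact_mod_cast n.factorial_ne_zero
  have h2 : (n : ℚ) + 1 ≠ 0 := by exact_mod_cast n.succ_ne_zero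
  simp only [one_div, eq_ratCast, Rat.cast_inv, Rat.cast_natCast]
  push_cast
  field_simp
  ring

theorem derivative_expμ : d⁄dX ℚ expμ = d⁄dX ℚ μ * expμ := by
  rw [expμ, derivative_subst hasSubst_μ, derivative_exp, mul_comm]

/-- The differential equation `μ' = -1/h² + 1/(e^h + e^{-h} - 2)`. -/
theorem mul_one_add_derivative_μ :
    (rescale (1 : ℚ) (exp ℚ) + rescale (-1 : ℚ) (exp ℚ) - 2) * (1 + X ^ 2 * d⁄dX ℚ μ) = X ^ 2 := by
  have h1 : rescale (1 : ℚ) (exp ℚ) * rescale (-1 : ℚ) (exp ℚ) = 1 := by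
    rw [exp_mul_exp_eq_exp_add]
    simp
  have h2 : rescale (1 : ℚ) (exp ℚ) = exp ℚ := by simp
  rw [h2] at h1 ⊢
  have h3 := X_mul_exp_sub_one_mul_μ
  have h4 := congrArg (d⁄dX ℚ) h3
  simp only [map_sub, Derivation.leibniz, derivative_X, Derivation.map_one_eq_zero,
    derivative_exp, derivative_C, smul_eq_mul] at h4
  linear_combination rescale (-1 : ℚ) (exp ℚ) * (X * (exp ℚ - 1) * h4
    - (exp ℚ - 1 + X * exp ℚ) * h3)
    - ((exp ℚ - 2) * (1 + X ^ 2 * d⁄dX ℚ μ) - X ^ 2) * h1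

/-- The series of `b_{n+i}`. -/
def recessive (i : ℚ) : PowerSeries ℚ := laplace (rescale (-i) (exp ℚ) * expμ)

/-- By the differential equation of μ, the factor e^h + e^{-h} - 2 equals h^2 q with q (1 + h^2 μ')
= 1. Integration by parts applies, and the terms q and h^2 q μ' that it produces add up to 1. -/
theorem laplace_second_difference (j : ℚ) :
    laplace ((rescale (1 : ℚ) (exp ℚ) + rescale (-1 : ℚ) (exp ℚ) - 2) *
        (rescale j (exp ℚ) * expμ)) =
      X ^ 2 * laplace ((1 + rescale (1 : ℚ) (exp ℚ) - rescale (-1 : ℚ) (exp ℚ)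
        + C j * (rescale (1 : ℚ) (exp ℚ) + rescale (-1 : ℚ) (exp ℚ) - 2)) *
          (rescale j (exp ℚ) * expμ)) := by
  have hz := mul_one_add_derivative_μ
  set z := rescale (1 : ℚ) (exp ℚ) + rescale (-1 : ℚ) (exp ℚ) - 2 with hz0
  set q := (1 + X ^ 2 * d⁄dX ℚ μ)⁻¹ with hq
  have hq1 : q * (1 + X ^ 2 * d⁄dX ℚ μ) = 1 := PowerSeries.inv_mul_cancel _ (by simp)
  have hzq : z = X ^ 2 * q := by linear_combination q * hz - z * hq1
  have hdz : d⁄dX ℚ z = rescale (1 : ℚ) (exp ℚ) - rescale (-1 : ℚ) (exp ℚ) := by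
    rw [hz0, map_sub, map_add, derivative_rescale_exp, derivative_rescale_exp,
      ← map_ofNat (C (R := ℚ)) 2, derivative_C]
    simp
    ring
  have hX : X ^ 2 * (q * (rescale j (exp ℚ) * expμ)) = z * (rescale j (exp ℚ) * expμ) := by
    rw [hzq, mul_assoc]
  rw [← hX, laplace_X_sq_mul, hX, Derivation.leibniz, hdz, Derivation.leibniz,
    derivative_rescale_exp, derivative_expμ]
  simp only [smul_eq_mul]
  congr 2
  linear_combination (rescale j (exp ℚ) * expμ) * hq1
    + (rescale j (exp ℚ) * expμ) * d⁄dX ℚ μ * hzq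

/-- The three-term recurrence at n - j: second differences in n are factors e^h + e^{-h} - 2 under
the integral. -/
theorem recessive_shift (j : ℚ) :
    recessive (-j - 1) + recessive (1 - j) - 2 * recessive (-j) =
      X ^ 2 * (recessive (-j) + recessive (-j - 1) - recessive (1 - j)
        + C j * (recessive (-j - 1) + recessive (1 - j) - 2 * recessive (-j))) := by
  have h := laplace_second_difference j
  have h1 : rescale (1 : ℚ) (exp ℚ) * rescale j (exp ℚ) = rescale (-(-j - 1)) (exp ℚ) := by
    rw [exp_mul_exp_eq_exp_add]
    ring_nf
  have h2 : rescale (-1 : ℚ) (exp ℚ) * rescale j (exp ℚ) = rescale (-(1 - j)) (exp ℚ) := by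
    rw [exp_mul_exp_eq_exp_add]
    ring_nf
  have hC : (2 : PowerSeries ℚ) = C 2 := (map_ofNat (C (R := ℚ)) 2).symm
  have h3 : (rescale (1 : ℚ) (exp ℚ) + rescale (-1 : ℚ) (exp ℚ) - 2) *
        (rescale j (exp ℚ) * expμ) = rescale (-(-j - 1)) (exp ℚ) * expμ
          + rescale (-(1 - j)) (exp ℚ) * expμ - C 2 * (rescale (- -j) (exp ℚ) * expμ) := by
    rw [← h1, ← h2, neg_neg, ← hC]
    ring
  have h4 : (1 + rescale (1 : ℚ) (exp ℚ) - rescale (-1 : ℚ) (exp ℚ)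
        + C j * (rescale (1 : ℚ) (exp ℚ) + rescale (-1 : ℚ) (exp ℚ) - 2)) *
          (rescale j (exp ℚ) * expμ) = rescale (- -j) (exp ℚ) * expμ
          + rescale (-(-j - 1)) (exp ℚ) * expμ - rescale (-(1 - j)) (exp ℚ) * expμ
          + C j * (rescale (-(-j - 1)) (exp ℚ) * expμ
          + rescale (-(1 - j)) (exp ℚ) * expμ - C 2 * (rescale (- -j) (exp ℚ) * expμ)) := by
    rw [← h1, ← h2, neg_neg, ← hC]
    ring
  rw [h3, h4] at h
  simp only [map_add, map_sub, laplace_C_mul] at h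
  rw [hC]
  exact h

theorem recessive_recurrence :
    (1 + X ^ 2) * recessive 1 = (2 + X ^ 2) * recessive 0 - (1 - X ^ 2) * recessive (-1) := by
  have h := recessive_shift 0
  norm_num at h
  linear_combination h

theorem recessive_recurrence' :
    (1 - 2 * X ^ 2) * recessive (-2) = (2 - X ^ 2) * recessive (-1) - recessive 0 := by
  have h := recessive_shift 1
  norm_num at h
  linear_combination h

theorem flow_rescale (i z : ℚ) (x : ℕ → PowerSeries ℚ) :
    rescale z (flow i x) = flow i fun r => rescale z (x r) := by
  ext N
  simp only [coeff_rescale, coeff_flow, mul_sum]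
  exact sum_congr rfl fun _ _ => by ring

theorem coeff_laplace_expμ (m : ℕ) : coeff m (laplace expμ) = (-1) ^ m * c m := by
  rw [coeff_laplace, c, ← mul_assoc, ← mul_pow, ← Finset.Nat.sum_antidiagonal_swap,
    Finset.Nat.sum_antidiagonal_eq_sum_range_succ_mk]
  norm_num only [one_pow, one_mul]
  refine sum_congr rfl fun j hj => ?_
  have hj' : j ≤ m := by simpa [Nat.lt_succ_iff] using hj
  simp only [Prod.swap_prod_mk, besselCoeff]
  rw [Nat.cast_sub hj']
  congr 3
  ring

/-- The product L(t) L(-t) is even, so only the coefficients of t^{2k} survive, and these define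
d_k. -/
theorem expand_mk_d :
    expand 2 two_ne_zero (PowerSeries.mk d) = laplace expμ * rescale (-1) (laplace expμ) := by
  ext N
  have h : coeff N (laplace expμ * rescale (-1) (laplace expμ)) =
      ∑ p ∈ antidiagonal N, (-1) ^ p.1 * c p.1 * c p.2 := by
    rw [coeff_mul]
    refine sum_congr rfl fun p _ => ?_
    rw [coeff_rescale, coeff_laplace_expμ, coeff_laplace_expμ, ← mul_assoc ((-1) ^ p.2),
      ← mul_pow]
    norm_num
  rw [h]
  by_cases h2 : 2 ∣ N
  · obtain ⟨k, rfl⟩ := h2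
    rw [coeff_expand_mul, coeff_mk, d, Finset.Nat.sum_antidiagonal_eq_sum_range_succ_mk]
  · rw [coeff_expand_of_not_dvd _ _ _ h2]
    have hodd : Odd N := by rwa [← Nat.not_even_iff_odd, even_iff_two_dvd]
    have h3 : ∑ p ∈ antidiagonal N, (-1) ^ p.1 * c p.1 * c p.2 =
        -∑ p ∈ antidiagonal N, (-1) ^ p.1 * c p.1 * c p.2 := by
      conv_lhs => rw [← Finset.Nat.sum_antidiagonal_swap]
      rw [← sum_neg_distrib]
      refine sum_congr rfl fun p hp => ?_
      have hp' := HasAntidiagonal.mem_antidiagonal.1 hp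
      have h4 : (-1 : ℚ) ^ p.1 * (-1) ^ p.2 = -1 := by
        rw [← pow_add, hp', hodd.neg_one_pow]
      have h5 : (-1 : ℚ) ^ p.1 * (-1) ^ p.1 = 1 := by
        rw [← mul_pow]
        norm_num
      simp only [Prod.fst_swap, Prod.snd_swap]
      linear_combination (-1) ^ p.1 * c p.1 * c p.2 * h4 - (-1) ^ p.2 * c p.1 * c p.2 * h5
    linarith

/-- Shifting both formal solutions by i shifts their product: all three shifts are flows, and the
flow is multiplicative. -/
theorem recessive_mul (i : ℚ) :
    recessive i * rescale (-1) (recessive i) =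
      expand 2 two_ne_zero (shift (3 / 2) i (PowerSeries.mk d)) := by
  have hy (r : ℕ) : X ^ r ∣ rescale (-1 : ℚ) (laplace (X ^ r * expμ)) := by
    obtain ⟨Q, hQ⟩ := X_pow_dvd_laplace r expμ
    refine X_pow_dvd_iff.2 fun m hm => ?_
    rw [hQ, coeff_rescale, coeff_X_pow_mul', if_neg (by omega), mul_zero]
  rw [recessive, laplace_exp_mul, flow_rescale, ← flow_expand]
  refine flow_mul i (fun r => X_pow_dvd_laplace r expμ) hy fun m => ?_
  -- This is -d/dn on t^3 f(t). The prefactors e^{-2/t} and e^{2/t} cancel, as do the leading terms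
  -- X f and -X f from `laplace_X_mul`.
  let T : PowerSeries ℚ →+ PowerSeries ℚ :=
    { toFun f := C (3 / 2) * (X ^ 2 * f) + C (1 / 2) * (X ^ 3 * d⁄dX ℚ f)
      map_zero' := by simp
      map_add' f g := by
        rw [map_add]
        ring }
  have hT (f) : T f = C (3 / 2) * (X ^ 2 * f) + C (1 / 2) * (X ^ 3 * d⁄dX ℚ f) := rfl
  have hC : (C (3 / 2) : PowerSeries ℚ) = C (3 / 4) + C (3 / 4) := by
    rw [← map_add]
    norm_num
  have hC2 : (C (1 / 2) : PowerSeries ℚ) * 2 = 1 := by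
    rw [← map_ofNat (C (R := ℚ)) 2, ← map_mul]
    norm_num
  have hres (f : PowerSeries ℚ) : d⁄dX ℚ (rescale (-1 : ℚ) f) = -rescale (-1 : ℚ) (d⁄dX ℚ f) := by
    ext n
    simp only [coeff_derivative, coeff_rescale, map_neg]
    ring
  have hresC (z : ℚ) : rescale (-1 : ℚ) (C z) = C z := by
    ext n
    rw [coeff_rescale, coeff_C]
    split_ifs with h <;> simp [h]
  refine leibniz_iterate T (fun r => laplace (X ^ r * expμ))
    (fun r => rescale (-1 : ℚ) (laplace (X ^ r * expμ)))
    (fun m => expand 2 two_ne_zero ((diffOp (3 / 2))^[m] (PowerSeries.mk d)))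
    (fun r s => ?_) ?_ (fun m => ?_) m
  · rw [hT, pow_succ' X r, pow_succ' X s, mul_assoc X, mul_assoc X, laplace_X_mul, laplace_X_mul,
      Derivation.leibniz, smul_eq_mul, smul_eq_mul, hres]
    simp only [map_add, map_mul, map_pow, rescale_X, hresC, map_neg, map_one]
    rw [hC]
    ring
  · simp [expand_mk_d]
  · rw [Function.iterate_succ_apply', hT, expand_apply, expand_apply,
      derivative_subst (HasSubst.X_pow two_ne_zero)]
    generalize (diffOp (3 / 2))^[m] (PowerSeries.mk d) = Q
    rw [diffOp, ← coe_substAlgHom (HasSubst.X_pow two_ne_zero), map_add, map_mul, map_mul, map_mul,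
      map_pow, substAlgHom_X, coe_substAlgHom, subst_C, derivative_pow, derivative_X]
    change C (3 / 2) * _ + _ = _
    push_cast
    linear_combination -(X ^ 4 * (d⁄dX ℚ Q).subst (X ^ 2 : PowerSeries ℚ)) * hC2

theorem expand_injective : Function.Injective (expand (R := ℚ) 2 two_ne_zero) := by
  intro P Q h
  ext k
  rw [← coeff_expand_mul 2 two_ne_zero P, h, coeff_expand_mul]

theorem recurrenceSeries_mk_d : recurrenceSeries (PowerSeries.mk d) = 0 := by
  apply expand_injective
  have hx1 := recessive_recurrence
  have hx2 := recessive_recurrence'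
  have hy1 := congrArg (rescale (-1 : ℚ)) hx1
  have hy2 := congrArg (rescale (-1 : ℚ)) hx2
  have h2 : rescale (-1 : ℚ) 2 = 2 := map_ofNat _ 2
  have hX : rescale (-1 : ℚ) X = -X := by simp [rescale_X]
  simp only [map_add, map_sub, map_mul, map_pow, map_one, h2, hX, neg_sq] at hy1 hy2
  have e2 : expand (R := ℚ) 2 two_ne_zero 2 = 2 := map_ofNat _ 2
  have e3 : expand (R := ℚ) 2 two_ne_zero 3 = 3 := map_ofNat _ 3
  have h0 := recessive_mul 0
  rw [shift_zero] at h0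
  rw [recurrenceSeries]
  simp only [map_add, map_sub, map_mul, map_pow, map_one, map_neg, map_zero, expand_X, e2, e3]
  rw [← recessive_mul, ← recessive_mul, ← recessive_mul, ← h0]
  generalize rescale (-1 : ℚ) (recessive 1) = y1 at *
  generalize rescale (-1 : ℚ) (recessive 0) = y0 at *
  generalize rescale (-1 : ℚ) (recessive (-1)) = y3 at *
  generalize rescale (-1 : ℚ) (recessive (-2)) = y2 at *
  generalize recessive 1 = x1 at *
  generalize recessive 0 = x0 at *
  generalize recessive (-1) = x3 at *
  generalize recessive (-2) = x2 at *
  generalize (X : PowerSeries ℚ) ^ 2 = u at *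
  -- The multipliers 2 - u and (1 - u)(2 + u) eliminate the mixed terms x0 y3 + x3 y0.
  linear_combination (2 - u) * ((1 + u) * y1) * hx1
    + (2 - u) * ((2 + u) * x0 - (1 - u) * x3) * hy1
    - (1 - u) * (2 + u) * ((1 - 2 * u) * y2 * hx2 + ((2 - u) * x3 - x0) * hy2)

theorem constantCoeff_subst_of_zero (f : PowerSeries ℚ) {g : PowerSeries ℚ}
    (hg : constantCoeff g = 0) : constantCoeff (f.subst g : PowerSeries ℚ) = constantCoeff f := by
  rw [← coeff_zero_eq_constantCoeff_apply, coeff_subst' (HasSubst.of_constantCoeff_zero' hg),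
    finsum_eq_single _ 0]
  · simp
  · intro n hn
    simp [hg, hn]

theorem constantCoeff_μ : constantCoeff μ = 0 := by
  rw [← coeff_zero_eq_constantCoeff_apply]
  norm_num [μ, bernoulli_one]

theorem d_zero : d 0 = 1 := by
  have h : constantCoeff expμ = 1 := by
    rw [expμ, constantCoeff_subst_of_zero _ constantCoeff_μ]
    simp
  simp [d, c, h]

end FormalSolution

end HadamardExp
end

noncomputable section
namespace HadamardExp

open PowerSeries Finset

/-! ### From a first order system to a third order differential equation -/

section EulerOperator

/-- Twice the operator `X d/dX - (k + 1/2)`. -/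
def eulerOp (k : ℕ) (F : PowerSeries ℚ) : PowerSeries ℚ :=
  2 * (X * d⁄dX ℚ F) - (2 * (k : PowerSeries ℚ) + 1) * F

theorem coeff_eulerOp (k n : ℕ) (F : PowerSeries ℚ) :
    coeff n (eulerOp k F) = (2 * n - 2 * k - 1) * coeff n F := by
  have h2 : (2 : PowerSeries ℚ) = C 2 := (map_ofNat (C (R := ℚ)) 2).symm
  have h : (2 * (k : PowerSeries ℚ) + 1) = C (2 * (k : ℚ) + 1) := by simp [h2]
  rw [eulerOp, h, h2, map_sub, coeff_C_mul, coeff_C_mul]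
  cases n with
  | zero => simp; ring
  | succ n =>
    rw [coeff_succ_X_mul, coeff_derivative]
    push_cast
    ring

variable {c w G Y : PowerSeries ℚ}

theorem derivative_ofNat (k : ℕ) [k.AtLeastTwo] :
    d⁄dX ℚ (ofNat(k) : PowerSeries ℚ) = 0 := by
  rw [← map_ofNat (C (R := ℚ)) k, derivative_C]

/-- Here F = (8X)^{k+1} N / w^{2(k+1)}: the power of X reduces the operator of index k + 1 to that
of index 0, and differentiating the power of w produces the term 4(k+1) c w N. -/
theorem eulerOp_succ_mul (k : ℕ) (dw : d⁄dX ℚ w = 8 * c) {F N N' : PowerSeries ℚ}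
    (h : w ^ (2 * (k + 1)) * F = (8 * X) ^ (k + 1) * N)
    (hN : w ^ 2 * eulerOp 0 N = 8 * X * (N' + 4 * ((k : PowerSeries ℚ) + 1) * c * w * N)) :
    w ^ (2 * (k + 2)) * eulerOp (k + 1) F = (8 * X) ^ (k + 2) * N' := by
  have hd := congrArg (d⁄dX ℚ) h
  simp only [Derivation.leibniz, derivative_pow, dw, derivative_X, derivative_ofNat,
    smul_eq_mul, Nat.add_sub_cancel, show 2 * (k + 1) - 1 = 2 * k + 1 by omega] at hd
  push_cast at hd
  simp only [eulerOp, Nat.cast_add, Nat.cast_one, Nat.cast_zero] at hN ⊢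
  have e (z : PowerSeries ℚ) : z ^ (2 * (k + 2)) = z ^ (2 * k) * z ^ 4 := by ring
  have e' (z : PowerSeries ℚ) : z ^ (2 * (k + 1)) = z ^ (2 * k) * z ^ 2 := by ring
  have e'' (z : PowerSeries ℚ) : z ^ (2 * k + 1) = z ^ (2 * k) * z := by ring
  simp only [e', e''] at h hd
  rw [e]
  generalize w ^ (2 * k) = v at *
  simp only [pow_succ] at *
  linear_combination 2 * X * w ^ 2 * hd
    - (32 * ((k : PowerSeries ℚ) + 1) * X * c * w + (2 * ((k : PowerSeries ℚ) + 1) + 1) * w ^ 2) * h 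
    + (8 * X : PowerSeries ℚ) ^ (k + 1) * hN

/-- The variables c and w stand for cosh 8X and sinh 8X. The system expresses every Euler derivative
of G through G and Y with coefficients polynomial in c and w, up to powers of X and w; the asserted
relation then becomes an identity modulo c^2 = 1 + w^2. -/
theorem euler_ode (hw0 : w ≠ 0) (hc : c ^ 2 = 1 + w ^ 2)
    (dc : d⁄dX ℚ c = 8 * w) (dw : d⁄dX ℚ w = 8 * c)
    (hG : w ^ 2 * eulerOp 0 G = 8 * X * ((2 - 2 * c - c * w) * G + 2 * c * w ^ 2 * Y))
    (hY : 2 * (w ^ 2 * eulerOp 0 Y) = 8 * X * (3 * c * G + (4 + 4 * c - 10 * c * w) * Y)) :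
    (2 * (c - w) ^ 2 - 6 + 6 * (c + w) ^ 2 - 2 * (c + w) ^ 4)
        * eulerOp 2 (eulerOp 1 (eulerOp 0 G))
      + (-5 * (c - w) ^ 2 - 5 + 17 * (c + w) ^ 2 - 7 * (c + w) ^ 4)
        * (32 * X * eulerOp 1 (eulerOp 0 G))
      + (3 * (c - w) ^ 2 + 1 + 13 * (c + w) ^ 2 - 5 * (c + w) ^ 4)
        * ((32 * X) ^ 2 * eulerOp 0 G)
      + (1 + 3 * (c + w) ^ 2) * ((32 * X) ^ 3 * G) = 0 := by
  have h1 : w ^ (2 * 1) * eulerOp 0 G =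
      (8 * X) ^ 1 * ((2 - 2 * c - c * w) * G + 2 * c * w ^ 2 * Y) := by
    linear_combination hG
  have h2 : w ^ (2 * 2) * eulerOp 1 (eulerOp 0 G) = (8 * X) ^ 2 *
      ((8 + 12 * w + 10 * w ^ 2 + 8 * w ^ 3 + 4 * w ^ 4 - 8 * c - 12 * c * w) * G
        + (-12 * w ^ 3 - 8 * w ^ 5 + 8 * c * w ^ 2) * Y) := by
    refine eulerOp_succ_mul 0 dw h1 ?_
    simp only [eulerOp] at hG hY ⊢
    simp only [map_add, map_sub, Derivation.leibniz, derivative_pow, dw, dc,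
      derivative_ofNat, smul_eq_mul]
    push_cast at hG hY ⊢
    linear_combination (2 - 2 * c - c * w) * hG + c * w ^ 2 * hY
      + 8 * X * ((4 + 12 * w + 6 * w ^ 2) * G - 12 * w ^ 3 * Y) * hc
  have h3 : w ^ (2 * 3) * eulerOp 2 (eulerOp 1 (eulerOp 0 G)) = (8 * X) ^ 3 *
      ((32 + 120 * w + 132 * w ^ 2 + 96 * w ^ 3 + 80 * w ^ 4 - 32 * c - 120 * c * w - 104 * c * w
        ^ 2 - 84 * c * w ^ 3 - 32 * c * w ^ 4 - 16 * c * w ^ 5) * G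
        + (-120 * w ^ 3 - 96 * w ^ 5 + 32 * c * w ^ 2 + 104 * c * w ^ 4 + 32 * c * w ^ 6) * Y) := by
    refine eulerOp_succ_mul 1 dw h2 ?_
    simp only [eulerOp] at hG hY ⊢
    simp only [map_add, map_sub, map_neg, Derivation.leibniz, derivative_pow, dw, dc,
      derivative_ofNat, smul_eq_mul]
    push_cast at hG hY ⊢
    linear_combination
      (8 + 12 * w + 10 * w ^ 2 + 8 * w ^ 3 + 4 * w ^ 4 - 8 * c - 12 * c * w) * hG
      + (-6 * w ^ 3 - 4 * w ^ 5 + 4 * c * w ^ 2) * hY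
      + 8 * X * ((16 + 96 * w + 96 * w ^ 2) * G - 96 * w ^ 3 * Y) * hc
  refine (mul_eq_zero.1 ?_).resolve_left (pow_ne_zero 6 hw0)
  generalize eulerOp 2 (eulerOp 1 (eulerOp 0 G)) = F3 at *
  generalize eulerOp 1 (eulerOp 0 G) = F2 at *
  generalize eulerOp 0 G = F1 at *
  linear_combination
    (2 * (c - w) ^ 2 - 6 + 6 * (c + w) ^ 2 - 2 * (c + w) ^ 4) * h3
    + (-5 * (c - w) ^ 2 - 5 + 17 * (c + w) ^ 2 - 7 * (c + w) ^ 4) * (32 * X * w ^ 2) * h2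
    + (3 * (c - w) ^ 2 + 1 + 13 * (c + w) ^ 2 - 5 * (c + w) ^ 4) * ((32 * X) ^ 2 * w ^ 4) * h1
    + (8 * X) ^ 3 * ((
      192 + 720 * w + 504 * w ^ 2 - 864 * w ^ 3 - 1232 * w ^ 4 - 80 * w ^ 5 + 104 * w ^ 6 + 224 *
      w ^ 7 + 112 * w ^ 8 - 192 * c - 976 * c * w - 1296 * c * w ^ 2 - 1016 * c * w ^ 3 + 368 * c
      * w ^ 4 + 856 * c * w ^ 5 + 672 * c * w ^ 6 + 336 * c * w ^ 7 - 64 * c ^ 2 + 16 * c ^ 2 * w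
      + 472 * c ^ 2 * w ^ 2 + 1200 * c ^ 2 * w ^ 3 + 1416 * c ^ 2 * w ^ 4 + 672 * c ^ 2 * w ^ 5 +
      336 * c ^ 2 * w ^ 6 + 64 * c ^ 3 + 240 * c ^ 3 * w + 432 * c ^ 3 * w ^ 2 + 504 * c ^ 3 * w ^
      3 + 224 * c ^ 3 * w ^ 4 + 112 * c ^ 3 * w ^ 5) * G + (
      -720 * w ^ 3 + 864 * w ^ 5 + 80 * w ^ 7 - 224 * w ^ 9 + 192 * c * w ^ 2 + 1296 * c * w ^ 4 -
      368 * c * w ^ 6 - 672 * c * w ^ 8 - 16 * c ^ 2 * w ^ 3 - 1200 * c ^ 2 * w ^ 5 - 672 * c ^ 2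
      * w ^ 7 - 64 * c ^ 3 * w ^ 2 - 432 * c ^ 3 * w ^ 4 - 224 * c ^ 3 * w ^ 6) * Y) * hc

end EulerOperator

end HadamardExp
end

noncomputable section
namespace HadamardExp

open PowerSeries Finset

/-! ### The Borel transform in closed form and its differential equation -/

section BorelTransform

/-- `cosh(8X)`. -/
def coshSeries : PowerSeries ℚ :=
  C (1 / 2) * (rescale (8 : ℚ) (exp ℚ) + rescale (-8 : ℚ) (exp ℚ))

/-- `sinh(8X)`. -/
def sinhSeries : PowerSeries ℚ :=
  C (1 / 2) * (rescale (8 : ℚ) (exp ℚ) - rescale (-8 : ℚ) (exp ℚ))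

/-- `sinh(8X)/(8X)`. -/
def sinhcSeries : PowerSeries ℚ := PowerSeries.mk fun n => coeff (n + 1) sinhSeries / 8

/-- `tanh(4X)`. -/
def tanhSeries : PowerSeries ℚ := sinhSeries * (1 + coshSeries)⁻¹

/-- `(1 + 4X)^{-1/2}`. -/
def invSqrtSeries : PowerSeries ℚ := PowerSeries.mk fun m => (-1) ^ m * (m.centralBinom : ℚ)

/-- `√(2π/X) e^{-1/X} I_1(1/X)`. -/
def besselSeries : PowerSeries ℚ :=
  PowerSeries.mk fun j => (∏ i ∈ range j, ((2 * (i : ℚ) + 1) ^ 2 - 4)) / (8 ^ j * (j ! : ℚ))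

/-- `e^{-tanh(4X)}`. -/
def expTanhSeries : PowerSeries ℚ := (exp ℚ).subst (-tanhSeries)

/-- `(sinh(8X)/(8X))^{-1/2}`. -/
def invSqrtSinhcSeries : PowerSeries ℚ := invSqrtSeries.subst (C (1 / 4) * (sinhcSeries - 1))

/-- The Borel transform of the series of the `d_k`, at the argument `16X`. -/
def borelSeries : PowerSeries ℚ :=
  expTanhSeries * invSqrtSinhcSeries * besselSeries.subst sinhSeries

theorem C_half_mul_two : (C (1 / 2) : PowerSeries ℚ) * 2 = 1 := by
  rw [← map_ofNat (C (R := ℚ)) 2, ← map_mul]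
  norm_num

theorem coshSeries_add_sinhSeries : coshSeries + sinhSeries = rescale (8 : ℚ) (exp ℚ) := by
  rw [coshSeries, sinhSeries]
  linear_combination rescale (8 : ℚ) (exp ℚ) * C_half_mul_two

theorem coshSeries_sub_sinhSeries : coshSeries - sinhSeries = rescale (-8 : ℚ) (exp ℚ) := by
  rw [coshSeries, sinhSeries]
  linear_combination rescale (-8 : ℚ) (exp ℚ) * C_half_mul_two

theorem coshSeries_sq : coshSeries ^ 2 = 1 + sinhSeries ^ 2 := by
  have h : (coshSeries + sinhSeries) * (coshSeries - sinhSeries) = 1 := by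
    rw [coshSeries_add_sinhSeries, coshSeries_sub_sinhSeries, exp_mul_exp_eq_exp_add]
    simp
  linear_combination h

theorem derivative_coshSeries : d⁄dX ℚ coshSeries = 8 * sinhSeries := by
  have h8 : (C 8 : PowerSeries ℚ) = 8 := map_ofNat _ 8
  rw [coshSeries, sinhSeries, Derivation.leibniz, derivative_C, map_add, derivative_rescale_exp,
    derivative_rescale_exp, map_neg, h8]
  simp only [smul_eq_mul]
  ring

theorem derivative_sinhSeries : d⁄dX ℚ sinhSeries = 8 * coshSeries := by
  have h8 : (C 8 : PowerSeries ℚ) = 8 := map_ofNat _ 8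
  rw [coshSeries, sinhSeries, Derivation.leibniz, derivative_C, map_sub, derivative_rescale_exp,
    derivative_rescale_exp, map_neg, h8]
  simp only [smul_eq_mul]
  ring

theorem coeff_sinhSeries (n : ℕ) :
    coeff n sinhSeries = (8 ^ n - (-8) ^ n) / (2 * (n ! : ℚ)) := by
  rw [sinhSeries, coeff_C_mul, map_sub, coeff_rescale, coeff_rescale, coeff_exp]
  simp only [one_div, eq_ratCast, Rat.cast_inv, Rat.cast_natCast]
  field_simp

theorem constantCoeff_sinhSeries : constantCoeff sinhSeries = 0 := by
  rw [← coeff_zero_eq_constantCoeff_apply, coeff_sinhSeries]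
  simp

theorem constantCoeff_coshSeries : constantCoeff coshSeries = 1 := by
  rw [← coeff_zero_eq_constantCoeff_apply, coshSeries, coeff_C_mul, map_add, coeff_rescale,
    coeff_rescale, coeff_exp]
  norm_num

theorem sinhSeries_ne_zero : sinhSeries ≠ 0 := by
  intro h
  have h1 := congrArg (coeff 1) h
  rw [coeff_sinhSeries] at h1
  norm_num at h1

theorem sinhSeries_eq : sinhSeries = 8 * (X * sinhcSeries) := by
  have h8 : (8 : PowerSeries ℚ) = C 8 := (map_ofNat (C (R := ℚ)) 8).symm
  ext n
  rw [h8, coeff_C_mul]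
  cases n with
  | zero => simp [constantCoeff_sinhSeries]
  | succ n =>
    rw [coeff_succ_X_mul, sinhcSeries, coeff_mk]
    ring

theorem constantCoeff_sinhcSeries : constantCoeff sinhcSeries = 1 := by
  rw [← coeff_zero_eq_constantCoeff_apply, sinhcSeries, coeff_mk, coeff_sinhSeries]
  norm_num

theorem hasSubst_sinhSeries : HasSubst sinhSeries :=
  HasSubst.of_constantCoeff_zero' constantCoeff_sinhSeries

theorem hasSubst_neg_tanhSeries : HasSubst (-tanhSeries) :=
  HasSubst.of_constantCoeff_zero' (by simp [tanhSeries, constantCoeff_sinhSeries])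

theorem hasSubst_sinhcSeries : HasSubst (C (1 / 4) * (sinhcSeries - 1)) :=
  HasSubst.of_constantCoeff_zero' (by simp [constantCoeff_sinhcSeries])

theorem inv_mul_one_add_coshSeries : (1 + coshSeries)⁻¹ * (1 + coshSeries) = 1 :=
  PowerSeries.inv_mul_cancel _ (by rw [map_add, constantCoeff_coshSeries]; norm_num)

theorem derivative_tanhSeries : d⁄dX ℚ tanhSeries = 8 * (1 + coshSeries)⁻¹ := by
  rw [tanhSeries, Derivation.leibniz, derivative_inv', map_add, Derivation.map_one_eq_zero,
    derivative_coshSeries, derivative_sinhSeries]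
  simp only [smul_eq_mul]
  have h1 := inv_mul_one_add_coshSeries
  have h2 := coshSeries_sq
  generalize (1 + coshSeries)⁻¹ = y at *
  linear_combination 8 * y ^ 2 * h2 - 8 * y * (coshSeries - 1) * h1

theorem derivative_expTanhSeries :
    d⁄dX ℚ expTanhSeries = -(8 * (1 + coshSeries)⁻¹) * expTanhSeries := by
  rw [expTanhSeries, derivative_subst hasSubst_neg_tanhSeries, derivative_exp, map_neg,
    derivative_tanhSeries]
  ring

theorem derivative_invSqrtSeries :
    (1 + 4 * X) * d⁄dX ℚ invSqrtSeries = -2 * invSqrtSeries := by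
  have h2 : (-2 : PowerSeries ℚ) = C (-2) := by rw [map_neg, map_ofNat]
  have h4 : (4 : PowerSeries ℚ) = C 4 := (map_ofNat (C (R := ℚ)) 4).symm
  have key (n : ℕ) : ((n : ℚ) + 1) * ((n + 1).centralBinom : ℚ) =
      2 * (2 * n + 1) * n.centralBinom := by
    exact_mod_cast Nat.succ_mul_centralBinom_succ n
  ext n
  rw [h2, h4, add_mul, one_mul, map_add, mul_assoc, coeff_C_mul, coeff_C_mul, coeff_derivative]
  simp only [invSqrtSeries, coeff_mk]
  cases n with
  | zero => simp [Nat.centralBinom]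
  | succ n =>
    rw [coeff_succ_X_mul, coeff_derivative, coeff_mk]
    have := key (n + 1)
    push_cast at this ⊢
    linear_combination (-1) ^ (n + 1 + 1) * this

theorem derivative_sinhcSeries : sinhcSeries + X * d⁄dX ℚ sinhcSeries = coshSeries := by
  have h := congrArg (d⁄dX ℚ) sinhSeries_eq
  rw [derivative_sinhSeries] at h
  simp only [Derivation.leibniz, derivative_X, derivative_ofNat, smul_eq_mul] at h
  have h8 : (8 : PowerSeries ℚ) ≠ 0 := by
    rw [← map_ofNat (C (R := ℚ)) 8]
    simp
  apply mul_left_cancel₀ h8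
  linear_combination -h

theorem derivative_invSqrtSinhcSeries :
    2 * (sinhcSeries * d⁄dX ℚ invSqrtSinhcSeries) =
      -(invSqrtSinhcSeries * d⁄dX ℚ sinhcSeries) := by
  have hs := hasSubst_sinhcSeries
  have h := congrArg (substAlgHom hs) derivative_invSqrtSeries
  have n2 : substAlgHom (R := ℚ) hs 2 = 2 := map_ofNat _ 2
  have n4 : substAlgHom (R := ℚ) hs 4 = 4 := map_ofNat _ 4
  simp only [map_mul, map_add, map_one, map_neg, n2, n4, substAlgHom_X] at h
  rw [coe_substAlgHom] at h
  have hq : (4 : PowerSeries ℚ) * C (1 / 4) = 1 := by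
    rw [← map_ofNat (C (R := ℚ)) 4, ← map_mul]
    norm_num
  rw [invSqrtSinhcSeries, derivative_subst hs, Derivation.leibniz, derivative_C, map_sub,
    Derivation.map_one_eq_zero]
  simp only [smul_eq_mul]
  linear_combination 2 * C (1 / 4) * d⁄dX ℚ sinhcSeries * h
    - (2 * (sinhcSeries - 1) * (d⁄dX ℚ invSqrtSeries).subst (C (1 / 4) * (sinhcSeries - 1))
      * C (1 / 4) * d⁄dX ℚ sinhcSeries + invSqrtSeries.subst (C (1 / 4) * (sinhcSeries - 1))
      * d⁄dX ℚ sinhcSeries) * hq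

theorem besselSeries_ode :
    4 * (X ^ 2 * d⁄dX ℚ (d⁄dX ℚ besselSeries)) =
      8 * d⁄dX ℚ besselSeries - 8 * (X * d⁄dX ℚ besselSeries) + 3 * besselSeries := by
  have h3 : (3 : PowerSeries ℚ) = C 3 := (map_ofNat (C (R := ℚ)) 3).symm
  have h4 : (4 : PowerSeries ℚ) = C 4 := (map_ofNat (C (R := ℚ)) 4).symm
  have h8 : (8 : PowerSeries ℚ) = C 8 := (map_ofNat (C (R := ℚ)) 8).symm
  have key (j : ℕ) : 8 * ((j : ℚ) + 1) * coeff (j + 1) besselSeries =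
      ((2 * (j : ℚ) + 1) ^ 2 - 4) * coeff j besselSeries := by
    simp only [besselSeries, coeff_mk, prod_range_succ, Nat.factorial_succ]
    have h1 : (j ! : ℚ) ≠ 0 := by exact_mod_cast j.factorial_ne_zero
    have h2 : (j : ℚ) + 1 ≠ 0 := by exact_mod_cast j.succ_ne_zero
    push_cast
    field_simp
    ring
  ext j
  rw [h3, h4, h8, map_add, map_sub, coeff_C_mul, coeff_C_mul, coeff_C_mul, coeff_C_mul, pow_two,
    mul_assoc]
  rcases j with _ | _ | j
  · have := key 0
    simp [coeff_derivative] at this ⊢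
    linarith
  · have := key 1
    simp [coeff_derivative, coeff_succ_X_mul] at this ⊢
    linarith
  · have := key (j + 2)
    simp only [coeff_succ_X_mul, coeff_derivative]
    push_cast at this ⊢
    linarith

/-- Y is `borelSeries` with its Bessel factor replaced by the derivative of that factor. The other
two factors have elementary logarithmic derivatives, and Bessel's equation closes the system. -/
theorem borelSeries_euler :
    ∃ Y : PowerSeries ℚ,
      sinhSeries ^ 2 * eulerOp 0 borelSeries = 8 * X * ((2 - 2 * coshSeries
        - coshSeries * sinhSeries) * borelSeries + 2 * coshSeries * sinhSeries ^ 2 * Y) ∧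
      2 * (sinhSeries ^ 2 * eulerOp 0 Y) = 8 * X * (3 * coshSeries * borelSeries
        + (4 + 4 * coshSeries - 10 * coshSeries * sinhSeries) * Y) := by
  have hs := hasSubst_sinhSeries
  have hB := congrArg (substAlgHom hs) besselSeries_ode
  have n3 : substAlgHom (R := ℚ) hs 3 = 3 := map_ofNat _ 3
  have n4 : substAlgHom (R := ℚ) hs 4 = 4 := map_ofNat _ 4
  have n8 : substAlgHom (R := ℚ) hs 8 = 8 := map_ofNat _ 8
  simp only [map_mul, map_add, map_sub, map_pow, n3, n4, n8, substAlgHom_X] at hB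
  rw [coe_substAlgHom] at hB
  have dB0 : d⁄dX ℚ (besselSeries.subst sinhSeries) =
      (d⁄dX ℚ besselSeries).subst sinhSeries * (8 * coshSeries) := by
    rw [derivative_subst hs, derivative_sinhSeries]
  have dB1 : d⁄dX ℚ ((d⁄dX ℚ besselSeries).subst sinhSeries) =
      (d⁄dX ℚ (d⁄dX ℚ besselSeries)).subst sinhSeries * (8 * coshSeries) := by
    rw [derivative_subst hs, derivative_sinhSeries]
  have hι := inv_mul_one_add_coshSeries
  have hc := coshSeries_sq
  have hwι : sinhSeries ^ 2 * (1 + coshSeries)⁻¹ = coshSeries - 1 := by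
    linear_combination (coshSeries - 1) * hι - (1 + coshSeries)⁻¹ * hc
  have hR : 2 * sinhSeries * (X * d⁄dX ℚ invSqrtSinhcSeries) =
      -(8 * X * invSqrtSinhcSeries * coshSeries) + sinhSeries * invSqrtSinhcSeries := by
    rw [sinhSeries_eq, ← derivative_sinhcSeries]
    linear_combination 8 * X ^ 2 * derivative_invSqrtSinhcSeries
  have dε := derivative_expTanhSeries
  refine ⟨expTanhSeries * invSqrtSinhcSeries * (d⁄dX ℚ besselSeries).subst sinhSeries, ?_, ?_⟩
  · rw [eulerOp, borelSeries, Derivation.leibniz, Derivation.leibniz, dε, dB0]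
    simp only [smul_eq_mul]
    generalize besselSeries.subst sinhSeries = B0 at *
    generalize (d⁄dX ℚ besselSeries).subst sinhSeries = B1 at *
    generalize (1 + coshSeries)⁻¹ = y at *
    push_cast
    linear_combination -16 * X * expTanhSeries * invSqrtSinhcSeries * B0 * hwι
      + sinhSeries * expTanhSeries * B0 * hR
  · rw [eulerOp, borelSeries, Derivation.leibniz, Derivation.leibniz, dε, dB1]
    simp only [smul_eq_mul]
    generalize besselSeries.subst sinhSeries = B0 at *
    generalize (d⁄dX ℚ besselSeries).subst sinhSeries = B1 at *
    generalize (d⁄dX ℚ (d⁄dX ℚ besselSeries)).subst sinhSeries = B2 at *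
    generalize (1 + coshSeries)⁻¹ = y at *
    push_cast
    linear_combination -32 * X * expTanhSeries * invSqrtSinhcSeries * B1 * hwι
      + 2 * sinhSeries * expTanhSeries * B1 * hR
      + 8 * X * expTanhSeries * invSqrtSinhcSeries * coshSeries * hB

/-- Since (cosh 8X ± sinh 8X)^2 = e^{±16X}, the coefficients are combinations of e^{-16iX} for i =
1, 0, -1, -2, the four shifts in the recurrence. -/
theorem borelSeries_ode :
    (2 * rescale (-16 : ℚ) (exp ℚ) - 6 + 6 * rescale (16 : ℚ) (exp ℚ)
        - 2 * rescale (32 : ℚ) (exp ℚ)) * eulerOp 2 (eulerOp 1 (eulerOp 0 borelSeries))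
      + (-5 * rescale (-16 : ℚ) (exp ℚ) - 5 + 17 * rescale (16 : ℚ) (exp ℚ)
        - 7 * rescale (32 : ℚ) (exp ℚ)) * (32 * X * eulerOp 1 (eulerOp 0 borelSeries))
      + (3 * rescale (-16 : ℚ) (exp ℚ) + 1 + 13 * rescale (16 : ℚ) (exp ℚ)
        - 5 * rescale (32 : ℚ) (exp ℚ)) * ((32 * X) ^ 2 * eulerOp 0 borelSeries)
      + (1 + 3 * rescale (16 : ℚ) (exp ℚ)) * ((32 * X) ^ 3 * borelSeries) = 0 := by
  obtain ⟨Y, hG, hY⟩ := borelSeries_euler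
  have h := euler_ode sinhSeries_ne_zero coshSeries_sq derivative_coshSeries
    derivative_sinhSeries hG hY
  have e1 : (coshSeries - sinhSeries) ^ 2 = rescale (-16 : ℚ) (exp ℚ) := by
    rw [coshSeries_sub_sinhSeries, pow_two, exp_mul_exp_eq_exp_add]
    norm_num
  have e2 : (coshSeries + sinhSeries) ^ 2 = rescale (16 : ℚ) (exp ℚ) := by
    rw [coshSeries_add_sinhSeries, pow_two, exp_mul_exp_eq_exp_add]
    norm_num
  have e3 : (coshSeries + sinhSeries) ^ 4 = rescale (32 : ℚ) (exp ℚ) := by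
    rw [show (4 : ℕ) = 2 * 2 from rfl, pow_mul, e2, pow_two, exp_mul_exp_eq_exp_add]
    norm_num
  rwa [e1, e2, e3] at h

end BorelTransform

end HadamardExp
end

noncomputable section
namespace HadamardExp

open PowerSeries Finset

/-! ### Translating the differential equation into the recurrence -/

section Coefficients

/-- The coefficients `d_k`, computed from the Borel transform. -/
def borelCoeff (k : ℕ) : ℚ :=
  (ascPochhammer ℚ k).eval (1 / 2) / 16 ^ k * coeff k borelSeries

theorem ascPochhammer_eval_add (m n : ℕ) (x : ℚ) :
    (ascPochhammer ℚ (m + n)).eval x =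
      (ascPochhammer ℚ m).eval x * (ascPochhammer ℚ n).eval (x + m) := by
  rw [← ascPochhammer_mul]
  simp

theorem ascPochhammer_eval_ne_zero (a m : ℕ) : (ascPochhammer ℚ m).eval (1 / 2 - (a : ℚ)) ≠ 0 := by
  induction m with
  | zero => simp
  | succ m ih =>
    rw [ascPochhammer_succ_eval]
    refine mul_ne_zero ih fun h => ?_
    have h2 : (1 + 2 * (m : ℤ)) = 2 * a := by
      have : (1 : ℚ) + 2 * m = 2 * a := by linarith
      exact_mod_cast this
    omega

/-- Both sides are Γ(M+1/2) Γ(k+1/2) / (Γ(1/2) Γ(k+1/2-a)). The factor (1/2)_M no longer depends on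
k, so it leaves the convolution in the next lemma. -/
theorem ascPochhammer_half_mul (a M k r : ℕ) (h : k + r = M + a) :
    (ascPochhammer ℚ k).eval (1 / 2) * (ascPochhammer ℚ r).eval ((k : ℚ) + (1 / 2 - a)) =
      (ascPochhammer ℚ M).eval (1 / 2) * (ascPochhammer ℚ a).eval ((k : ℚ) + (1 / 2 - a)) := by
  have h1 := ascPochhammer_eval_add k r (1 / 2 - (a : ℚ))
  have h2 := ascPochhammer_eval_add a M (1 / 2 - (a : ℚ))
  have h3 := ascPochhammer_eval_add k a (1 / 2 - (a : ℚ))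
  have h4 := ascPochhammer_eval_add a k (1 / 2 - (a : ℚ))
  rw [h, add_comm M a, h2] at h1
  rw [add_comm k a, h4] at h3
  rw [show (1 / 2 : ℚ) - a + a = 1 / 2 by ring] at *
  rw [show (1 / 2 : ℚ) - a + k = k + (1 / 2 - a) by ring] at *
  apply mul_left_cancel₀ (ascPochhammer_eval_ne_zero a a)
  linear_combination (ascPochhammer ℚ r).eval ((k : ℚ) + (1 / 2 - a)) * h3
    - (ascPochhammer ℚ a).eval ((k : ℚ) + (1 / 2 - a)) * h1

/-- The series of `(n + i)^a` times the shifted sequence, up to a power of `X`. -/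
def halfShift (a : ℕ) (i : ℚ) (P : PowerSeries ℚ) : PowerSeries ℚ := shift (1 / 2 - (a : ℚ)) i P

/-- The dictionary of the Borel transform: a shift by i is multiplication by e^{-16iX}, and the a-th
power of n + i is a product of a Euler operators, which is the form of F in `hF`. -/
theorem coeff_halfShift_borelCoeff {F : PowerSeries ℚ} (a : ℕ) (i : ℚ)
    (hF : ∀ k : ℕ, coeff k F = 2 ^ a * (ascPochhammer ℚ a).eval ((k : ℚ) + (1 / 2 - a)) *
      coeff k borelSeries) (M : ℕ) :
    coeff (M + a) (halfShift a i (PowerSeries.mk borelCoeff)) =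
      (ascPochhammer ℚ M).eval (1 / 2) / (16 ^ (M + a) * 2 ^ a) *
        coeff (M + a) (rescale (-16 * i) (exp ℚ) * F) := by
  rw [halfShift, coeff_shift, mul_comm _ F, coeff_mul, mul_sum]
  refine sum_congr rfl fun p hp => ?_
  have hp' := HasAntidiagonal.mem_antidiagonal.1 hp
  have h := ascPochhammer_half_mul a M p.1 p.2 hp'
  rw [hF, coeff_rescale, coeff_exp, coeff_mk, borelCoeff, ← hp', pow_add,
    show (-16 * i) = 16 * (-i) by ring, mul_pow]
  simp only [eq_ratCast, Rat.cast_div, Rat.cast_one, Rat.cast_natCast]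
  have h3 : (p.2 ! : ℚ) ≠ 0 := by exact_mod_cast p.2.factorial_ne_zero
  generalize (ascPochhammer ℚ p.1).eval (1 / 2) = z1 at *
  generalize (ascPochhammer ℚ p.2).eval ((p.1 : ℚ) + (1 / 2 - a)) = z2 at *
  generalize (ascPochhammer ℚ M).eval (1 / 2) = z3 at *
  generalize (ascPochhammer ℚ a).eval ((p.1 : ℚ) + (1 / 2 - a)) = z4 at *
  field_simp
  linear_combination coeff p.1 borelSeries * i ^ p.2 * (-1) ^ p.2 * h

/-- Each polynomial coefficient is rewritten in powers of n + i for its own shift i, so that every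
term has a direct Borel transform. -/
theorem recurrenceSeries_eq (P : PowerSeries ℚ) :
    recurrenceSeries P =
      C 2 * halfShift 3 1 P - C 5 * (X * halfShift 2 1 P) + C 3 * (X * (X * halfShift 1 1 P))
      - C 6 * halfShift 3 0 P - C 5 * (X * halfShift 2 0 P) + X * (X * halfShift 1 0 P)
        + X * (X * (X * halfShift 0 0 P))
      + C 6 * halfShift 3 (-1) P + C 17 * (X * halfShift 2 (-1) P)
        + C 13 * (X * (X * halfShift 1 (-1) P)) + C 3 * (X * (X * (X * halfShift 0 (-1) P)))
      - C 2 * halfShift 3 (-2) P - C 7 * (X * halfShift 2 (-2) P)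
        - C 5 * (X * (X * halfShift 1 (-2) P)) := by
  have e0 (i : ℚ) : halfShift 0 i P = (1 + C i * X) * shift (3 / 2) i P := by
    rw [one_add_mul_shift, halfShift]
    norm_num
  have e (a : ℕ) (i : ℚ) : halfShift (a + 1) i P = (1 + C i * X) * halfShift a i P := by
    rw [halfShift, halfShift, one_add_mul_shift]
    push_cast
    ring_nf
  have e1 (i : ℚ) : halfShift 1 i P = (1 + C i * X) ^ 2 * shift (3 / 2) i P := by
    rw [e, e0]
    ring
  have e2 (i : ℚ) : halfShift 2 i P = (1 + C i * X) ^ 3 * shift (3 / 2) i P := by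
    rw [e, e1]
    ring
  have e3 (i : ℚ) : halfShift 3 i P = (1 + C i * X) ^ 4 * shift (3 / 2) i P := by
    rw [e, e2]
    ring
  have h (k : ℕ) [k.AtLeastTwo] :
      (C (ofNat(k) : ℚ) : PowerSeries ℚ) = OfNat.ofNat k := map_ofNat _ _
  simp only [e0, e1, e2, e3, shift_zero, recurrenceSeries, h, map_neg, map_one, map_zero]
  ring

/-- These degrees impose no condition, in accordance with the factor 8N at N = 0; the comparison
with the differential equation covers only degrees at least 3. -/
theorem coeff_recurrenceSeries_of_le_two (P : PowerSeries ℚ) {n : ℕ} (hn : n ≤ 2) :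
    coeff n (recurrenceSeries P) = 0 := by
  rw [recurrenceSeries, recurrence_combination]
  interval_cases n
  · simp only [map_add, coeff_C_mul, coeff_zero_X_mul, coeff_zero_shift]
    ring
  · change coeff (0 + 1) _ = 0
    simp only [map_add, coeff_C_mul, coeff_succ_X_mul, coeff_zero_X_mul, coeff_zero_shift,
      zero_add, coeff_one_shift]
    ring
  · change coeff (0 + 1 + 1) _ = 0
    simp only [map_add, coeff_C_mul, coeff_succ_X_mul, coeff_zero_X_mul, coeff_zero_shift,
      zero_add, coeff_one_shift]
    norm_num only [coeff_two_shift]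
    ring

theorem recurrenceSeries_mk_borelCoeff : recurrenceSeries (PowerSeries.mk borelCoeff) = 0 := by
  ext n
  rw [map_zero]
  rcases Nat.lt_or_ge n 3 with hn | hn
  · exact coeff_recurrenceSeries_of_le_two _ (by omega)
  obtain ⟨M, rfl⟩ := Nat.exists_eq_add_of_le' hn
  have h0 (i : ℚ) := coeff_halfShift_borelCoeff (F := borelSeries) 0 i (by simp) M
  have h1 (i : ℚ) := coeff_halfShift_borelCoeff (F := eulerOp 0 borelSeries) 1 i (fun k => by
    rw [coeff_eulerOp, ascPochhammer_one, Polynomial.eval_X]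
    push_cast
    ring) M
  have h2 (i : ℚ) := coeff_halfShift_borelCoeff (F := eulerOp 1 (eulerOp 0 borelSeries)) 2 i
    (fun k => by
      rw [coeff_eulerOp, coeff_eulerOp, ascPochhammer_succ_eval, ascPochhammer_one,
        Polynomial.eval_X]
      push_cast
      ring) M
  have h3 (i : ℚ) := coeff_halfShift_borelCoeff
    (F := eulerOp 2 (eulerOp 1 (eulerOp 0 borelSeries))) 3 i (fun k => by
      rw [coeff_eulerOp, coeff_eulerOp, coeff_eulerOp, ascPochhammer_succ_eval,
        ascPochhammer_succ_eval, ascPochhammer_one, Polynomial.eval_X]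
      push_cast
      ring) M
  have h (k : ℕ) [k.AtLeastTwo] :
      (OfNat.ofNat k : PowerSeries ℚ) = C (ofNat(k) : ℚ) := (map_ofNat _ _).symm
  have r0 : rescale (-16 * 0 : ℚ) (exp ℚ) = 1 := by
    rw [mul_zero, rescale_zero]
    simp
  -- Each factor X in `recurrenceSeries_eq` becomes 32X here, because the denominator 16^{M+a} 2^a
  -- changes by 32 with a.
  have ode :
      C 2 * (rescale (-16 * 1 : ℚ) (exp ℚ) * eulerOp 2 (eulerOp 1 (eulerOp 0 borelSeries)))
        - C 160 * (X * (rescale (-16 * 1 : ℚ) (exp ℚ) * eulerOp 1 (eulerOp 0 borelSeries)))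
        + C 3072 * (X * (X * (rescale (-16 * 1 : ℚ) (exp ℚ) * eulerOp 0 borelSeries)))
      - C 6 * (rescale (-16 * 0 : ℚ) (exp ℚ) * eulerOp 2 (eulerOp 1 (eulerOp 0 borelSeries)))
        - C 160 * (X * (rescale (-16 * 0 : ℚ) (exp ℚ) * eulerOp 1 (eulerOp 0 borelSeries)))
        + C 1024 * (X * (X * (rescale (-16 * 0 : ℚ) (exp ℚ) * eulerOp 0 borelSeries)))
        + C 32768 * (X * (X * (X * (rescale (-16 * 0 : ℚ) (exp ℚ) * borelSeries))))
      + C 6 * (rescale (-16 * -1 : ℚ) (exp ℚ) * eulerOp 2 (eulerOp 1 (eulerOp 0 borelSeries)))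
        + C 544 * (X * (rescale (-16 * -1 : ℚ) (exp ℚ) * eulerOp 1 (eulerOp 0 borelSeries)))
        + C 13312 * (X * (X * (rescale (-16 * -1 : ℚ) (exp ℚ) * eulerOp 0 borelSeries)))
        + C 98304 * (X * (X * (X * (rescale (-16 * -1 : ℚ) (exp ℚ) * borelSeries))))
      - C 2 * (rescale (-16 * -2 : ℚ) (exp ℚ) * eulerOp 2 (eulerOp 1 (eulerOp 0 borelSeries)))
        - C 224 * (X * (rescale (-16 * -2 : ℚ) (exp ℚ) * eulerOp 1 (eulerOp 0 borelSeries)))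
        - C 5120 * (X * (X * (rescale (-16 * -2 : ℚ) (exp ℚ) * eulerOp 0 borelSeries))) = 0 := by
    rw [r0]
    have h (k : ℕ) [k.AtLeastTwo] :
        (C (ofNat(k) : ℚ) : PowerSeries ℚ) = OfNat.ofNat k := map_ofNat _ _
    norm_num only [h]
    linear_combination borelSeries_ode
  have ode' := congrArg (coeff (M + 1 + 1 + 1)) ode
  rw [recurrenceSeries_eq]
  change coeff (M + 1 + 1 + 1) _ = 0
  simp only [map_add, map_sub, map_zero, coeff_C_mul, coeff_succ_X_mul] at ode' ⊢
  simp only [add_zero, pow_zero] at h0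
  change ∀ i, coeff (M + 1 + 1) _ = _ at h2
  change ∀ i, coeff (M + 1 + 1 + 1) _ = _ at h3
  simp only [h0, h1, h2, h3]
  rw [pow_add, pow_add, pow_add]
  linear_combination ((ascPochhammer ℚ M).eval (1 / 2) / (16 ^ M * 32768)) * ode'

theorem borelCoeff_zero : borelCoeff 0 = 1 := by
  have h1 : coeff 0 borelSeries = 1 := by
    rw [borelSeries, coeff_zero_eq_constantCoeff, map_mul, map_mul, expTanhSeries,
      invSqrtSinhcSeries, constantCoeff_subst_of_zero, constantCoeff_subst_of_zero,
      constantCoeff_subst_of_zero]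
    · simp [besselSeries, invSqrtSeries]
    · exact constantCoeff_sinhSeries
    · simp [constantCoeff_sinhcSeries]
    · simp [tanhSeries, constantCoeff_sinhSeries]
  simp only [borelCoeff, h1]
  simp

end Coefficients

end HadamardExp
end

noncomputable section
namespace HadamardExp

open PowerSeries Finset

/-! ### Integrality of the Borel coefficients -/

section Integrality

/-- The property that `w n * coeff n F` is an integer. -/
def IntegralAt (w : ℕ → ℕ) (n : ℕ) (F : PowerSeries ℚ) : Prop :=
  ∃ z : ℤ, (w n : ℚ) * coeff n F = z

variable {w : ℕ → ℕ} {n : ℕ} {F G : PowerSeries ℚ}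

theorem integralAt_sum {ι : Type*} (s : Finset ι) (f : ι → PowerSeries ℚ)
    (h : ∀ i ∈ s, IntegralAt w n (f i)) : IntegralAt w n (∑ i ∈ s, f i) := by
  choose! z hz using h
  refine ⟨∑ i ∈ s, z i, ?_⟩
  rw [map_sum, mul_sum, Int.cast_sum]
  exact sum_congr rfl hz

theorem IntegralAt.C_mul (h : IntegralAt w n F) (a : ℤ) : IntegralAt w n (C (a : ℚ) * F) := by
  obtain ⟨z, hz⟩ := h
  refine ⟨a * z, ?_⟩
  rw [coeff_C_mul, Int.cast_mul, ← hz]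
  ring

theorem IntegralAt.mul (hw : ∀ i j, w i * w j ∣ w (i + j))
    (hF : ∀ m ≤ n, IntegralAt w m F) (hG : ∀ m ≤ n, IntegralAt w m G) :
    IntegralAt w n (F * G) := by
  choose! f hf using hF
  choose! g hg using hG
  choose q hq using hw
  refine ⟨∑ p ∈ antidiagonal n, q p.1 p.2 * f p.1 * g p.2, ?_⟩
  rw [coeff_mul, mul_sum, Int.cast_sum]
  refine sum_congr rfl fun p hp => ?_
  have hp' := HasAntidiagonal.mem_antidiagonal.1 hp
  push_cast
  rw [← hf _ (show p.1 ≤ n by omega), ← hg _ (show p.2 ≤ n by omega), ← hp', hq]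
  push_cast
  ring

theorem integralAt_pow (hw : ∀ i j, w i * w j ∣ w (i + j)) (hF : ∀ n, IntegralAt w n F)
    (j n : ℕ) : IntegralAt w n (F ^ j) := by
  induction j generalizing n with
  | zero =>
    rw [pow_zero]
    rcases eq_or_ne n 0 with rfl | hn
    · exact ⟨w 0, by simp⟩
    · exact ⟨0, by simp [coeff_one, hn]⟩
  | succ j ih =>
    rw [pow_succ]
    exact IntegralAt.mul hw (fun m _ => ih m) fun m _ => hF m

theorem factorial_mul_dvd (i j : ℕ) : i ! * j ! ∣ (i + j)! :=
  Nat.factorial_mul_factorial_dvd_factorial_add i j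

theorem factorial_two_mul_dvd (i j : ℕ) : (2 * i)! * (2 * j)! ∣ (2 * (i + j))! := by
  rw [mul_add]
  exact Nat.factorial_mul_factorial_dvd_factorial_add _ _

theorem IntegralAt.two_mul (h : IntegralAt (fun k => k !) n F) :
    IntegralAt (fun k => (2 * k)!) n F := by
  obtain ⟨z, hz⟩ := h
  obtain ⟨q, hq⟩ := Nat.factorial_dvd_factorial (show n ≤ 2 * n by omega)
  refine ⟨q * z, ?_⟩
  beta_reduce at hz ⊢
  rw [hq]
  push_cast
  rw [← hz]
  ring

theorem integralAt_factorial_succ (h : IntegralAt (fun k => k !) n (d⁄dX ℚ F)) :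
    IntegralAt (fun k => k !) (n + 1) F := by
  obtain ⟨z, hz⟩ := h
  refine ⟨z, ?_⟩
  beta_reduce at hz ⊢
  rw [← hz, coeff_derivative, Nat.factorial_succ]
  push_cast
  ring

/-- Suited to differential equations: F' may be a polynomial in F, since its coefficients up to n
are controlled by those of F up to n. -/
theorem integralAt_factorial_of_derivative (h0 : ∃ z : ℤ, constantCoeff F = z)
    (h : ∀ n, (∀ m ≤ n, IntegralAt (fun k => k !) m F) →
      IntegralAt (fun k => k !) n (d⁄dX ℚ F)) (n : ℕ) :
    IntegralAt (fun k => k !) n F := by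
  induction n using Nat.strong_induction_on with
  | _ n ih =>
    cases n with
    | zero =>
      obtain ⟨z, hz⟩ := h0
      exact ⟨z, by simpa using hz⟩
    | succ n => exact integralAt_factorial_succ (h n fun m hm => ih m (by omega))

/-- Divided powers of exponential generating functions of integers. -/
theorem integralAt_divided_pow (h0 : constantCoeff F = 0)
    (hF : ∀ n, IntegralAt (fun k => k !) n F) (j n : ℕ) :
    IntegralAt (fun k => k !) n (C (1 / (j ! : ℚ)) * F ^ j) := by
  induction j generalizing n with
  | zero =>
    refine integralAt_factorial_of_derivative ⟨1, by simp⟩ (fun m _ => ⟨0, ?_⟩) n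
    simp
  | succ j ih =>
    refine integralAt_factorial_of_derivative ⟨0, by simp [h0]⟩ (fun m _ => ?_) n
    have h1 : d⁄dX ℚ (C (1 / ((j + 1)! : ℚ)) * F ^ (j + 1)) =
        C (1 / (j ! : ℚ)) * F ^ j * d⁄dX ℚ F := by
      have h2 : (C (1 / ((j + 1)! : ℚ)) : PowerSeries ℚ) * ((j : PowerSeries ℚ) + 1) =
          C (1 / (j ! : ℚ)) := by
        have h3 : ((j : PowerSeries ℚ) + 1) = C ((j : ℚ) + 1) := by simp
        rw [h3, ← map_mul, Nat.factorial_succ]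
        have h4 : (j ! : ℚ) ≠ 0 := by exact_mod_cast j.factorial_ne_zero
        have h5 : (j : ℚ) + 1 ≠ 0 := by exact_mod_cast j.succ_ne_zero
        push_cast
        congr 1
        field_simp
      rw [Derivation.leibniz, derivative_C, derivative_pow, ← h2]
      simp only [smul_eq_mul, Nat.add_sub_cancel]
      push_cast
      ring
    rw [h1]
    refine IntegralAt.mul factorial_mul_dvd (fun m _ => ih m) fun m _ => ?_
    obtain ⟨z, hz⟩ := hF (m + 1)
    refine ⟨z, ?_⟩
    beta_reduce at hz ⊢
    rw [← hz, coeff_derivative, Nat.factorial_succ]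
    push_cast
    ring

theorem coeff_subst_eq_sum (f : PowerSeries ℚ) {g : PowerSeries ℚ} (hg : constantCoeff g = 0)
    (k : ℕ) : coeff k (f.subst g : PowerSeries ℚ) =
      coeff k (∑ j ∈ range (k + 1), C (coeff j f) * g ^ j) := by
  rw [coeff_subst' (HasSubst.of_constantCoeff_zero' hg), finsum_eq_sum_of_support_subset
    (s := range (k + 1)), map_sum]
  · exact sum_congr rfl fun j _ => by rw [coeff_C_mul, smul_eq_mul]
  · intro j hj
    by_contra h
    have hX : X ^ j ∣ g ^ j := pow_dvd_pow_of_dvd (X_dvd_iff.2 hg) j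
    apply hj
    simp only [X_pow_dvd_iff.1 hX k (by simpa using h), smul_zero]

theorem integralAt_subst (f : PowerSeries ℚ) {g : PowerSeries ℚ} (hg : constantCoeff g = 0)
    (k : ℕ) (h : ∀ j, IntegralAt w k (C (coeff j f) * g ^ j)) :
    IntegralAt w k (f.subst g : PowerSeries ℚ) := by
  obtain ⟨z, hz⟩ := integralAt_sum (range (k + 1)) (fun j => C (coeff j f) * g ^ j)
    fun j _ => h j
  exact ⟨z, by rw [coeff_subst_eq_sum f hg, hz]⟩

/-- The integers are 0 for even n and 8^{n-1} for odd n. The factor 1/8 gained here absorbs the 8^j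
in the denominators of `besselSeries`. -/
theorem integralAt_sinhSeries_div (n : ℕ) :
    IntegralAt (fun k => k !) n (C (1 / 8) * sinhSeries) := by
  have h : (n ! : ℚ) * coeff n (C (1 / 8) * sinhSeries) = (8 ^ n - (-8) ^ n) / 16 := by
    have h1 : (n ! : ℚ) ≠ 0 := by exact_mod_cast n.factorial_ne_zero
    rw [coeff_C_mul, coeff_sinhSeries]
    field_simp
    ring
  rcases Nat.even_or_odd n with hn | ⟨m, rfl⟩
  · refine ⟨0, ?_⟩
    rw [h, hn.neg_pow]
    simp
  · refine ⟨8 ^ (2 * m), ?_⟩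
    rw [h, (odd_two_mul_add_one m).neg_pow]
    push_cast
    ring

theorem integralAt_sinhSeries (n : ℕ) : IntegralAt (fun k => k !) n sinhSeries := by
  have h : sinhSeries = C ((8 : ℤ) : ℚ) * (C (1 / 8) * sinhSeries) := by
    rw [← mul_assoc, ← map_mul]
    norm_num
  rw [h]
  exact (integralAt_sinhSeries_div n).C_mul 8

theorem integralAt_expTanhSeries (n : ℕ) : IntegralAt (fun k => k !) n expTanhSeries := by
  have hy := inv_mul_one_add_coshSeries
  set y := (1 + coshSeries)⁻¹ with hy0
  -- The constant term of y is 1/2. The series 2y has integral data and satisfies (2y)' = -4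
  -- sinh(8X) (2y)^2.
  have h1 (n : ℕ) : IntegralAt (fun k => k !) n (2 * y) := by
    refine integralAt_factorial_of_derivative ⟨1, ?_⟩ (fun m hm => ?_) n
    · have hc := congrArg constantCoeff hy
      rw [map_mul, map_add, map_one, constantCoeff_coshSeries] at hc
      rw [map_mul, map_ofNat]
      push_cast
      linarith
    · have h4 : (C ((-4 : ℤ) : ℚ) : PowerSeries ℚ) = -4 := by
        push_cast
        rw [map_neg, map_ofNat]
      have hd : d⁄dX ℚ (2 * y) = C ((-4 : ℤ) : ℚ) * (sinhSeries * (2 * y * (2 * y))) := by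
        rw [Derivation.leibniz, derivative_ofNat, hy0, derivative_inv', map_add,
          Derivation.map_one_eq_zero, derivative_coshSeries, h4]
        simp only [smul_eq_mul]
        ring
      rw [hd]
      refine IntegralAt.C_mul (IntegralAt.mul factorial_mul_dvd
        (fun _ _ => integralAt_sinhSeries _) fun k hk => ?_) _
      exact IntegralAt.mul factorial_mul_dvd (fun l hl => hm l (hl.trans hk))
        fun l hl => hm l (hl.trans hk)
  refine integralAt_factorial_of_derivative ⟨1, ?_⟩ (fun m hm => ?_) n
  · rw [expTanhSeries, constantCoeff_subst_of_zero]
    · simp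
    · simp [tanhSeries, constantCoeff_sinhSeries]
  · have h4 : (C ((-4 : ℤ) : ℚ) : PowerSeries ℚ) = -4 := by
      push_cast
      rw [map_neg, map_ofNat]
    have hd : d⁄dX ℚ expTanhSeries = C ((-4 : ℤ) : ℚ) * (2 * y * expTanhSeries) := by
      rw [derivative_expTanhSeries, h4]
      ring
    rw [hd]
    exact IntegralAt.C_mul (IntegralAt.mul factorial_mul_dvd (fun _ _ => h1 _) hm) _

/-- Each summand is an integer times a divided power of sinh(8X)/8. -/
theorem integralAt_besselSeries (n : ℕ) :
    IntegralAt (fun k => k !) n (besselSeries.subst sinhSeries : PowerSeries ℚ) := by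
  refine integralAt_subst _ constantCoeff_sinhSeries n fun j => ?_
  have h : C (coeff j besselSeries) * sinhSeries ^ j =
      C ((∏ i ∈ range j, ((2 * (i : ℤ) + 1) ^ 2 - 4) : ℤ) : ℚ) *
        (C (1 / (j ! : ℚ)) * (C (1 / 8) * sinhSeries) ^ j) := by
    rw [mul_pow, ← map_pow, ← mul_assoc, ← mul_assoc, ← map_mul, ← map_mul, besselSeries, coeff_mk]
    congr 2
    push_cast
    rw [one_div (8 : ℚ), inv_pow]
    field_simp
  rw [h]
  refine IntegralAt.C_mul (integralAt_divided_pow ?_ integralAt_sinhSeries_div j n) _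
  simp [constantCoeff_sinhSeries]

/-- The factor for which (2n)! is used instead of n!: the coefficient of X^{m+1} in (sinh(8X)/(8X) -
1)/4 has denominator dividing (m+2)!, and m + 2 ≤ 2(m+1). The outer series (1+4Z)^{-1/2} has integer
coefficients. -/
theorem integralAt_invSqrtSinhcSeries (n : ℕ) :
    IntegralAt (fun k => (2 * k)!) n invSqrtSinhcSeries := by
  have h1 (m : ℕ) : IntegralAt (fun k => (2 * k)!) m (C (1 / 4) * (sinhcSeries - 1)) := by
    rcases m with _ | m
    · exact ⟨0, by simp [constantCoeff_sinhcSeries]⟩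
    have h2 : coeff (m + 1) (C (1 / 4) * (sinhcSeries - 1)) =
        (8 ^ (m + 2) - (-8) ^ (m + 2)) / (64 * ((m + 2)! : ℚ)) := by
      rw [coeff_C_mul, map_sub, sinhcSeries, coeff_mk, coeff_sinhSeries, coeff_one,
        if_neg m.succ_ne_zero]
      field_simp
      ring
    obtain ⟨q, hq⟩ := Nat.factorial_dvd_factorial (show m + 2 ≤ 2 * (m + 1) by omega)
    have h3 : ((m + 2)! : ℚ) ≠ 0 := by exact_mod_cast (m + 2).factorial_ne_zero
    have h4 : ((2 * (m + 1))! : ℚ) = (m + 2)! * q := by exact_mod_cast hq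
    refine ⟨q * (8 ^ m - (-8) ^ m), ?_⟩
    rw [h2, h4]
    push_cast
    field_simp
    ring
  refine integralAt_subst _ (by simp [constantCoeff_sinhcSeries]) n fun j => ?_
  have h5 : coeff j invSqrtSeries = (((-1) ^ j * (j.centralBinom : ℤ) : ℤ) : ℚ) := by
    simp [invSqrtSeries]
  rw [h5]
  exact (integralAt_pow factorial_two_mul_dvd h1 j n).C_mul _

theorem integralAt_borelSeries (n : ℕ) : IntegralAt (fun k => (2 * k)!) n borelSeries :=
  IntegralAt.mul factorial_two_mul_dvd
    (fun _ _ => IntegralAt.mul factorial_two_mul_dvd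
      (fun _ _ => (integralAt_expTanhSeries _).two_mul)
      fun _ _ => integralAt_invSqrtSinhcSeries _)
    fun _ _ => (integralAt_besselSeries _).two_mul

theorem factorial_mul_ascPochhammer_half (k : ℕ) :
    (k ! : ℚ) * 4 ^ k * (ascPochhammer ℚ k).eval (1 / 2) = (2 * k)! := by
  induction k with
  | zero => simp
  | succ k ih =>
    rw [ascPochhammer_succ_eval, show 2 * (k + 1) = 2 * k + 1 + 1 by ring, Nat.factorial_succ,
      Nat.factorial_succ, Nat.factorial_succ]
    push_cast
    rw [← ih]
    ring

theorem exists_int_borelCoeff (k : ℕ) :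
    ∃ z : ℤ, (k ! : ℚ) * (2 ^ (6 * k) * borelCoeff k) = z := by
  obtain ⟨z, hz⟩ := integralAt_borelSeries k
  refine ⟨z, ?_⟩
  -- In 2^{6k} = 4^k 16^k, the factor 16^k cancels the scaling of the Borel transform and 4^k
  -- completes (2k)!.
  rw [← hz, ← factorial_mul_ascPochhammer_half, borelCoeff, pow_mul,
    show ((2 : ℚ) ^ 6) ^ k = 4 ^ k * 16 ^ k by rw [← mul_pow]; norm_num]
  field_simp

theorem mk_d_eq_mk_borelCoeff : PowerSeries.mk d = PowerSeries.mk borelCoeff := by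
  refine sub_eq_zero.1 (eq_zero_of_recurrenceSeries_eq_zero ?_ ?_)
  · rw [recurrenceSeries_sub, recurrenceSeries_mk_d, recurrenceSeries_mk_borelCoeff, sub_zero]
  · rw [map_sub, coeff_mk, coeff_mk, d_zero, borelCoeff_zero, sub_self]

theorem exists_int_d (k : ℕ) : ∃ z : ℤ, (k ! : ℚ) * (2 ^ (6 * k) * d k) = z := by
  have h := congrArg (coeff k) mk_d_eq_mk_borelCoeff
  rw [coeff_mk, coeff_mk] at h
  rw [h]
  exact exists_int_borelCoeff k

end Integrality

end HadamardExp
end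

noncomputable section
namespace HadamardExp

open PowerSeries Finset Filter Asymptotics Topology

/-! ### Calculus of asymptotic expansions in 1/n -/

section Expansion

/-- `f(n) ∼ ∑_k F_k n^{-k}` as `n → ∞`. -/
def HasExpansion (f : ℕ → ℝ) (F : PowerSeries ℝ) : Prop :=
  ∀ m : ℕ, (fun n : ℕ => f n - (trunc m F).eval ((n : ℝ)⁻¹)) =O[atTop]
    fun n : ℕ => ((n : ℝ)⁻¹) ^ m

theorem isBigO_eval_inv (Q : Polynomial ℝ) :
    (fun n : ℕ => Q.eval ((n : ℝ)⁻¹)) =O[atTop] fun _ : ℕ => (1 : ℝ) :=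
  ((Q.continuous.tendsto 0).comp tendsto_inv_atTop_nhds_zero_nat).isBigO_one ℝ

theorem isBigO_eval_inv_of_coeff_eq_zero {Q : Polynomial ℝ} {m : ℕ}
    (h : ∀ k < m, Q.coeff k = 0) :
    (fun n : ℕ => Q.eval ((n : ℝ)⁻¹)) =O[atTop] fun n : ℕ => ((n : ℝ)⁻¹) ^ m := by
  obtain ⟨R, rfl⟩ := Polynomial.X_pow_dvd_iff.2 h
  simpa using (isBigO_refl (fun n : ℕ => ((n : ℝ)⁻¹) ^ m) atTop).mul (isBigO_eval_inv R)

theorem HasExpansion.congr {f g : ℕ → ℝ} {F : PowerSeries ℝ} (h : HasExpansion f F)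
    (hfg : f =ᶠ[atTop] g) : HasExpansion g F := fun m =>
  (h m).congr' (hfg.mono fun n hn => by simp only [hn]) EventuallyEq.rfl

theorem hasExpansion_of_approx {f : ℕ → ℝ} {F : PowerSeries ℝ}
    (h : ∀ m, ∃ g G, HasExpansion g G ∧ (∀ k < m, coeff k F = coeff k G) ∧
      (fun n => f n - g n) =O[atTop] fun n : ℕ => ((n : ℝ)⁻¹) ^ m) : HasExpansion f F := by
  intro m
  obtain ⟨g, G, hG, hFG, hfg⟩ := h m
  have ht : trunc m F = trunc m G := by
    ext k
    simp only [coeff_trunc]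
    split_ifs with hk
    · exact hFG k hk
    · rfl
  rw [ht]
  exact (hfg.add (hG m)).congr_left fun n => by ring

theorem hasExpansion_eval_inv (Q : Polynomial ℝ) :
    HasExpansion (fun n => Q.eval ((n : ℝ)⁻¹)) (Q : PowerSeries ℝ) := by
  intro m
  refine (isBigO_eval_inv_of_coeff_eq_zero (Q := Q - trunc m (Q : PowerSeries ℝ))
    fun k hk => ?_).congr_left fun n => by rw [Polynomial.eval_sub]
  rw [Polynomial.coeff_sub, coeff_trunc, if_pos hk, Polynomial.coeff_coe, sub_self]

theorem hasExpansion_const (z : ℝ) : HasExpansion (fun _ => z) (C z) := by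
  simpa using hasExpansion_eval_inv (Polynomial.C z)

theorem hasExpansion_inv : HasExpansion (fun n => (n : ℝ)⁻¹) X := by
  simpa using hasExpansion_eval_inv Polynomial.X

theorem HasExpansion.add {f g : ℕ → ℝ} {F G : PowerSeries ℝ} (hf : HasExpansion f F)
    (hg : HasExpansion g G) : HasExpansion (fun n => f n + g n) (F + G) := fun m =>
  ((hf m).add (hg m)).congr_left fun n => by
    rw [map_add, Polynomial.eval_add]
    ring

theorem HasExpansion.isBigO_one {f : ℕ → ℝ} {F : PowerSeries ℝ} (hf : HasExpansion f F) :
    f =O[atTop] fun _ : ℕ => (1 : ℝ) := by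
  simpa using hf 0

theorem HasExpansion.mul {f g : ℕ → ℝ} {F G : PowerSeries ℝ} (hf : HasExpansion f F)
    (hg : HasExpansion g G) : HasExpansion (fun n => f n * g n) (F * G) := by
  intro m
  have h1 := (hf m).mul hg.isBigO_one
  have h2 := (isBigO_eval_inv (trunc m F)).mul (hg m)
  have h3 := isBigO_eval_inv_of_coeff_eq_zero
    (Q := trunc m F * trunc m G - trunc m (F * G)) (m := m) fun k hk => by
      rw [Polynomial.coeff_sub, coeff_trunc, if_pos hk, ← Polynomial.coeff_coe,
        Polynomial.coe_mul, coeff_mul, coeff_mul, sub_eq_zero]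
      refine sum_congr rfl fun p hp => ?_
      have hp' := HasAntidiagonal.mem_antidiagonal.1 hp
      rw [Polynomial.coeff_coe, Polynomial.coeff_coe, coeff_trunc, coeff_trunc, if_pos (by omega),
        if_pos (by omega)]
  simp only [mul_one, one_mul] at h1 h2
  refine ((h1.add h2).add h3).congr_left fun n => ?_
  rw [Polynomial.eval_sub, Polynomial.eval_mul]
  ring

theorem HasExpansion.const_mul {f : ℕ → ℝ} {F : PowerSeries ℝ} (hf : HasExpansion f F) (z : ℝ) :
    HasExpansion (fun n => z * f n) (C z * F) :=
  (hasExpansion_const z).mul hf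

theorem HasExpansion.sub {f g : ℕ → ℝ} {F G : PowerSeries ℝ} (hf : HasExpansion f F)
    (hg : HasExpansion g G) : HasExpansion (fun n => f n - g n) (F - G) := by
  have h := hf.add (hg.const_mul (-1))
  simpa [sub_eq_add_neg] using h

theorem HasExpansion.pow {f : ℕ → ℝ} {F : PowerSeries ℝ} (hf : HasExpansion f F) (k : ℕ) :
    HasExpansion (fun n => f n ^ k) (F ^ k) := by
  induction k with
  | zero => simpa using hasExpansion_const 1
  | succ k ih => simpa only [pow_succ] using ih.mul hf

theorem eq_zero_of_hasExpansion_zero {F : PowerSeries ℝ} (h : HasExpansion (fun _ => 0) F) :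
    F = 0 := by
  ext k
  rw [map_zero]
  induction k using Nat.strong_induction_on with
  | _ k ih =>
    have ht : trunc (k + 1) F = Polynomial.C (coeff k F) * Polynomial.X ^ k := by
      ext j
      rw [coeff_trunc, Polynomial.coeff_C_mul_X_pow]
      rcases lt_trichotomy j k with hj | rfl | hj
      · rw [if_pos (by omega), if_neg (by omega), ih j hj]
      · simp
      · rw [if_neg (by omega), if_neg (by omega)]
    have h1 := h (k + 1)
    simp only [ht, Polynomial.eval_mul, Polynomial.eval_C, Polynomial.eval_pow, Polynomial.eval_X,
      zero_sub] at h1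
    obtain ⟨M, hM⟩ := h1.bound
    have h2 : ∀ᶠ n : ℕ in atTop, |coeff k F| ≤ M * (n : ℝ)⁻¹ := by
      filter_upwards [hM, eventually_gt_atTop 0] with n hn hn0
      have hn1 : (0 : ℝ) < (n : ℝ)⁻¹ := by positivity
      rw [norm_neg, norm_mul, Real.norm_of_nonneg (pow_nonneg hn1.le _),
        Real.norm_of_nonneg (pow_nonneg hn1.le _), pow_succ', ← mul_assoc] at hn
      exact le_of_mul_le_mul_right hn (pow_pos hn1 k)
    have h3 : Tendsto (fun n : ℕ => M * (n : ℝ)⁻¹) atTop (𝓝 0) := by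
      simpa using tendsto_inv_atTop_nhds_zero_nat.const_mul M
    exact abs_nonpos_iff.1 (ge_of_tendsto h3 h2)

theorem eq_of_hasExpansion {f g : ℕ → ℝ} {F G : PowerSeries ℝ} (hf : HasExpansion f F)
    (hg : HasExpansion g G) (hfg : f =ᶠ[atTop] g) : F = G := by
  refine sub_eq_zero.1 (eq_zero_of_hasExpansion_zero ((hf.sub hg).congr ?_))
  filter_upwards [hfg] with n hn
  rw [hn, sub_self]

theorem ring_choose_neg (β : ℝ) (r : ℕ) :
    Ring.choose (-β) r = (-1) ^ r * (ascPochhammer ℝ r).eval β / (r ! : ℝ) := by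
  have h := Ring.factorial_nsmul_multichoose_eq_ascPochhammer β r
  rw [Polynomial.ascPochhammer_smeval_eq_eval, nsmul_eq_mul] at h
  have h1 : (r ! : ℝ) ≠ 0 := by exact_mod_cast r.factorial_ne_zero
  rw [Ring.choose_neg', ← h]
  field_simp
  simp [Int.negOnePow_def, Units.smul_def]

theorem eval_trunc (m : ℕ) (F : PowerSeries ℝ) (x : ℝ) :
    (trunc m F).eval x = ∑ k ∈ range m, coeff k F * x ^ k :=
  eval₂_trunc_eq_sum_range x (RingHom.id ℝ) m F

/-- The binomial series at i/n. -/
theorem hasExpansion_one_add_rpow (β i : ℝ) :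
    HasExpansion (fun n => (1 + i * (n : ℝ)⁻¹) ^ (-β)) (shift β i 1) := by
  intro m
  have h := (Real.one_add_rpow_hasFPowerSeriesAt_zero (a := -β)).isBigO_sub_partialSum_pow m
  have ht : Tendsto (fun n : ℕ => i * (n : ℝ)⁻¹) atTop (𝓝 0) := by
    simpa using tendsto_inv_atTop_nhds_zero_nat.const_mul i
  have h1 := h.comp_tendsto ht
  have h2 : (fun n : ℕ => ‖i * (n : ℝ)⁻¹‖ ^ m) =O[atTop] fun n : ℕ => ((n : ℝ)⁻¹) ^ m := by
    refine IsBigO.of_bound (|i| ^ m) (Eventually.of_forall fun n => ?_)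
    simp [mul_pow]
  refine (h1.trans h2).congr_left fun n => ?_
  simp only [Function.comp, zero_add]
  congr 1
  rw [FormalMultilinearSeries.partialSum, eval_trunc]
  refine sum_congr rfl fun r hr => ?_
  have hc : coeff r (shift β i 1) = (-i) ^ r * (ascPochhammer ℝ r).eval β / (r ! : ℝ) := by
    rw [coeff_shift, sum_eq_single (0, r)]
    · simp
    · rintro ⟨k, s⟩ hks hne
      have hk : k ≠ 0 := by
        rintro rfl
        apply hne
        simpa using hks
      simp [coeff_one, hk]
    · simp
  rw [hc, binomialSeries_apply, ring_choose_neg]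
  simp only [List.ofFn_const, List.prod_replicate, smul_eq_mul]
  rw [mul_pow, neg_pow]
  ring

theorem shift_add (α i : ℝ) (P Q : PowerSeries ℝ) :
    shift α i (P + Q) = shift α i P + shift α i Q := by
  ext N
  simp only [coeff_shift, map_add, add_mul, sum_add_distrib]

theorem hasExpansion_shift_polynomial (α i : ℝ) {g : ℕ → ℕ}
    (hg : ∀ᶠ n : ℕ in atTop, (g n : ℝ) = n + i) (Q : Polynomial ℝ) :
    HasExpansion (fun n => (1 + i * (n : ℝ)⁻¹) ^ (-α) * Q.eval ((g n : ℝ)⁻¹))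
      (shift α i (Q : PowerSeries ℝ)) := by
  induction Q using Polynomial.induction_on' with
  | add P Q hP hQ =>
    rw [Polynomial.coe_add, shift_add]
    refine (hP.add hQ).congr (Eventually.of_forall fun n => ?_)
    simp only [Polynomial.eval_add]
    ring
  | monomial k z =>
    have h : shift α i ((Polynomial.monomial k z : Polynomial ℝ) : PowerSeries ℝ) =
        C z * (X ^ k * shift (α + k) i 1) := by
      rw [← shift_X_pow_mul, ← shift_C_mul, ← Polynomial.C_mul_X_pow_eq_monomial]
      simp
    rw [h]
    refine (((hasExpansion_inv.pow k).mul
      (hasExpansion_one_add_rpow (α + k) i)).const_mul z).congr ?_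
    have hpos : ∀ᶠ n : ℕ in atTop, (0 : ℝ) < n + i :=
      (tendsto_natCast_atTop_atTop.atTop_add tendsto_const_nhds).eventually_gt_atTop 0
    filter_upwards [hg, hpos, eventually_gt_atTop 0] with n hn hn1 hn2
    have hn3 : (0 : ℝ) < n := by exact_mod_cast hn2
    have h1 : (n : ℝ) + i = n * (1 + i * (n : ℝ)⁻¹) := by
      field_simp
    have h2 : 0 < 1 + i * (n : ℝ)⁻¹ := by
      rw [h1] at hn1
      exact pos_of_mul_pos_right hn1 hn3.le
    rw [Polynomial.eval_monomial, hn, h1, neg_add, Real.rpow_add h2, Real.rpow_neg h2.le k,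
      Real.rpow_natCast, mul_inv, mul_pow, inv_pow, inv_pow]
    ring

/-- Truncation reduces to polynomials: the first m shifted coefficients involve only the first m of
F, and the remainder stays O(n^{-m}) because eventually g(n) ≥ n/2. -/
theorem HasExpansion.shift {f : ℕ → ℝ} {F : PowerSeries ℝ} (hf : HasExpansion f F) (α i : ℝ)
    {g : ℕ → ℕ} (hg : ∀ᶠ n : ℕ in atTop, (g n : ℝ) = n + i) :
    HasExpansion (fun n => (1 + i * (n : ℝ)⁻¹) ^ (-α) * f (g n)) (shift α i F) := by
  have htop : Tendsto (fun n : ℕ => (g n : ℝ)) atTop atTop :=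
    (tendsto_natCast_atTop_atTop.atTop_add tendsto_const_nhds).congr'
      (hg.mono fun n hn => hn.symm)
  have hgtop : Tendsto g atTop atTop := tendsto_natCast_atTop_iff.1 htop
  refine hasExpansion_of_approx fun m => ⟨_, _,
    hasExpansion_shift_polynomial α i hg (trunc m F), fun k hk => ?_, ?_⟩
  · rw [coeff_shift, coeff_shift]
    refine sum_congr rfl fun p hp => ?_
    have hp' := HasAntidiagonal.mem_antidiagonal.1 hp
    rw [Polynomial.coeff_coe, coeff_trunc, if_pos (by omega)]
  · have h1 := (hf m).comp_tendsto hgtop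
    have h2 := (hasExpansion_one_add_rpow α i).isBigO_one
    have h3 : (fun n : ℕ => ((g n : ℝ)⁻¹) ^ m) =O[atTop] fun n : ℕ => ((n : ℝ)⁻¹) ^ m := by
      refine IsBigO.pow (IsBigO.of_bound 2 ?_) m
      filter_upwards [hg, tendsto_natCast_atTop_atTop.eventually_gt_atTop (2 * |i|)] with n hn hn1
      have h4 := neg_abs_le i
      have h5 := abs_nonneg i
      have h6 : (n : ℝ) / 2 ≤ g n := by linarith
      have h7 : (0 : ℝ) < n := by linarith
      rw [norm_inv, norm_inv, Real.norm_of_nonneg (by positivity), Real.norm_of_nonneg h7.le]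
      calc ((g n : ℝ))⁻¹ ≤ ((n : ℝ) / 2)⁻¹ := inv_anti₀ (by positivity) h6
        _ = 2 * (n : ℝ)⁻¹ := by rw [inv_div, div_eq_mul_inv]
    refine ((h2.mul (h1.trans h3)).congr_left fun n => ?_).congr_right fun n => ?_
    · simp only [Function.comp]
      ring
    · simp

/-- If `x(n) = n^{-α} F(1/n)`, then `x(n + i) = n^{-α} (shift α i F)(1/n)`. -/
theorem HasExpansion.rpow_mul_shift {x : ℕ → ℝ} {F : PowerSeries ℝ} {α : ℝ}
    (hf : HasExpansion (fun n => (n : ℝ) ^ α * x n) F) (i : ℝ)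
    {g : ℕ → ℕ} (hg : ∀ᶠ n : ℕ in atTop, (g n : ℝ) = n + i) :
    HasExpansion (fun n => (n : ℝ) ^ α * x (g n)) (HadamardExp.shift α i F) := by
  refine (hf.shift α i hg).congr ?_
  have hpos : ∀ᶠ n : ℕ in atTop, (0 : ℝ) < n + i :=
    (tendsto_natCast_atTop_atTop.atTop_add tendsto_const_nhds).eventually_gt_atTop 0
  filter_upwards [hg, hpos, eventually_gt_atTop 0] with n hn hn1 hn2
  have hn3 : (0 : ℝ) < n := by exact_mod_cast hn2
  have h1 : (n : ℝ) + i = n * (1 + i * (n : ℝ)⁻¹) := by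
    field_simp
  have h2 : 0 < 1 + i * (n : ℝ)⁻¹ := by
    rw [h1] at hn1
    exact pos_of_mul_pos_right hn1 hn3.le
  rw [hn, h1, Real.mul_rpow hn3.le h2.le, Real.rpow_neg h2.le]
  have h3 := (Real.rpow_pos_of_pos h2 α).ne'
  field_simp

theorem IsAsymptoticSeries.hasExpansion {f d : ℕ → ℝ} (h : IsAsymptoticSeries f d) :
    HasExpansion f (PowerSeries.mk d) := by
  have h0 : ∀ m, 0 < m → (fun n : ℕ => f n - (trunc m (PowerSeries.mk d)).eval ((n : ℝ)⁻¹))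
      =O[atTop] fun n : ℕ => ((n : ℝ)⁻¹) ^ m := fun m hm => by
    refine ((h m hm).congr_left fun n => ?_).congr_right fun n => ?_
    · simp [eval_trunc, div_eq_mul_inv]
    · simp
  intro m
  rcases Nat.eq_zero_or_pos m with rfl | hm
  -- Order 0 is not part of `IsAsymptoticSeries`; it follows from order 1.
  · have h1 : (fun n : ℕ => ((n : ℝ)⁻¹) ^ 1) =O[atTop] fun _ : ℕ => (1 : ℝ) := by
      simpa using hasExpansion_inv.isBigO_one
    have h2 := ((h0 1 one_pos).trans h1).add
      (isBigO_eval_inv (trunc 1 (PowerSeries.mk d)))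
    simpa using h2
  · exact h0 m hm

end Expansion

end HadamardExp
end

noncomputable section
namespace HadamardExp

open Filter Topology

/-! ### Recurrence and Casoratian of the Maclaurin coefficients -/

section Coefficients

/-- The quotient form yields differentiability together with the differentiated equation, so
smoothness need not be known beforehand. -/
theorem hasDerivAt_of_eq_div_sq {G ψ : ℝ → ℝ} {ψ' z : ℝ} (hz : z < 1)
    (hG : ∀ y < 1, G y = ψ y / (1 - y) ^ 2) (hψ : HasDerivAt ψ ψ' z) :
    HasDerivAt G (deriv G z) z ∧ (1 - z) ^ 2 * deriv G z = ψ' + 2 * (1 - z) * G z := by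
  have hz' : 1 - z ≠ 0 := by linarith
  have h1 : HasDerivAt (fun y : ℝ => (1 - y) ^ 2) (-(2 * (1 - z))) z := by
    refine (((hasDerivAt_id z).const_sub 1).pow 2).congr_deriv ?_
    simp
  have h2 := hψ.div h1 (pow_ne_zero 2 hz')
  have h3 : G =ᶠ[𝓝 z] ψ / fun y => (1 - y) ^ 2 := by
    filter_upwards [Iio_mem_nhds hz] with y hy
    exact hG y hy
  have h4 := h2.congr_of_eventuallyEq h3
  rw [h4.deriv]
  refine ⟨h4, ?_⟩
  rw [hG z hz]
  field_simp
  ring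

variable {f : ℝ → ℝ} {κ : ℝ}

/-- Repeated differentiation of (1-z)^2 f' = f - κ(1-z), with κ = 0 for `f₀` and κ = 1 for `f₁`. The
inhomogeneity survives only at n = 0. -/
theorem iteratedDeriv_recurrence
    (hf : ∀ z < 1, HasDerivAt f ((f z - κ * (1 - z)) / (1 - z) ^ 2) z) (n : ℕ) :
    ∀ z < 1, HasDerivAt (iteratedDeriv n f) (iteratedDeriv (n + 1) f z) z ∧
      HasDerivAt (iteratedDeriv (n + 1) f) (iteratedDeriv (n + 2) f z) z ∧
      (1 - z) ^ 2 * iteratedDeriv (n + 2) f z =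
        (1 + 2 * (n + 1) * (1 - z)) * iteratedDeriv (n + 1) f z
          - n * (n + 1) * iteratedDeriv n f z + if n = 0 then κ else 0 := by
  induction n with
  | zero =>
    intro z hz
    have h1 : HasDerivAt f (iteratedDeriv 1 f z) z := by
      rw [iteratedDeriv_one]
      exact (hf z hz).differentiableAt.hasDerivAt
    have h2 : HasDerivAt (fun y => f y - κ * (1 - y)) (iteratedDeriv 1 f z + κ) z := by
      refine (h1.sub (((hasDerivAt_id z).const_sub 1).const_mul κ)).congr_deriv ?_
      simp
    have h3 := hasDerivAt_of_eq_div_sq (G := iteratedDeriv 1 f) hz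
      (fun y hy => by rw [iteratedDeriv_one]; exact (hf y hy).deriv) h2
    rw [← iteratedDeriv_succ] at h3
    refine ⟨by simpa using h1, h3.1, ?_⟩
    rw [h3.2]
    simp
    ring
  | succ n ih =>
    intro z hz
    obtain ⟨h1, h2, h3⟩ := ih z hz
    have h4 : HasDerivAt (fun y => (1 + 2 * ((n : ℝ) + 1) * (1 - y)) * iteratedDeriv (n + 1) f y
          - n * (n + 1) * iteratedDeriv n f y + if n = 0 then κ else 0)
        (-(2 * ((n : ℝ) + 1)) * iteratedDeriv (n + 1) f z
          + (1 + 2 * ((n : ℝ) + 1) * (1 - z)) * iteratedDeriv (n + 2) f z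
          - n * (n + 1) * iteratedDeriv (n + 1) f z) z := by
      have h5 : HasDerivAt (fun y : ℝ => 1 + 2 * ((n : ℝ) + 1) * (1 - y))
          (-(2 * ((n : ℝ) + 1))) z := by
        refine ((((hasDerivAt_id z).const_sub 1).const_mul
          (2 * ((n : ℝ) + 1))).const_add 1).congr_deriv ?_
        simp
      exact ((h5.mul h2).sub (h1.const_mul _)).add_const _
    have h6 := hasDerivAt_of_eq_div_sq (G := iteratedDeriv (n + 2) f) hz
      (fun y hy => by
        have hy' : 1 - y ≠ 0 := by linarith
        rw [eq_div_iff (pow_ne_zero 2 hy'), mul_comm]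
        exact (ih y hy).2.2) h4
    rw [← iteratedDeriv_succ] at h6
    refine ⟨h2, h6.1, ?_⟩
    rw [h6.2]
    push_cast
    simp
    ring

theorem maclaurinCoeff_one
    (hf : ∀ z < 1, HasDerivAt f ((f z - κ * (1 - z)) / (1 - z) ^ 2) z) :
    maclaurinCoeff f 1 = f 0 - κ := by
  simp [maclaurinCoeff, iteratedDeriv_one, (hf 0 one_pos).deriv]

theorem maclaurinCoeff_recurrence
    (hf : ∀ z < 1, HasDerivAt f ((f z - κ * (1 - z)) / (1 - z) ^ 2) z) (n : ℕ) :
    ((n : ℝ) + 2) * maclaurinCoeff f (n + 2) = (2 * n + 3) * maclaurinCoeff f (n + 1)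
      - n * maclaurinCoeff f n + if n = 0 then κ else 0 := by
  have h := (iteratedDeriv_recurrence hf n 0 one_pos).2.2
  simp only [sub_zero, one_pow, one_mul, mul_one] at h
  have h1 : (n ! : ℝ) ≠ 0 := by exact_mod_cast n.factorial_ne_zero
  have h2 : (n : ℝ) + 1 ≠ 0 := by exact_mod_cast n.succ_ne_zero
  have h3 : (n : ℝ) + 2 ≠ 0 := by exact_mod_cast (n + 1).succ_ne_zero
  simp only [maclaurinCoeff, h, Nat.factorial_succ]
  push_cast
  split_ifs with hn
  · subst hn
    field_simp
    simp
    ring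
  · field_simp
    ring

theorem hasDerivAt_f₀ {z : ℝ} (hz : z < 1) :
    HasDerivAt f₀ ((f₀ z - 0 * (1 - z)) / (1 - z) ^ 2) z := by
  have hz' : 1 - z ≠ 0 := by linarith
  have h := ((hasDerivAt_id z).div ((hasDerivAt_id z).const_sub 1) hz').exp
  refine h.congr_deriv ?_
  simp [f₀]
  field_simp

theorem integrableOn_exp_neg_div {x : ℝ} (hx : 0 < x) :
    MeasureTheory.IntegrableOn (fun t => Real.exp (-t) / t) (Set.Ioi x) := by
  have h1 : MeasureTheory.IntegrableOn (fun t => x⁻¹ * Real.exp (-t)) (Set.Ioi x) :=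
    (integrableOn_exp_neg_Ioi x).const_mul x⁻¹
  refine MeasureTheory.Integrable.mono' h1 ?_ ?_
  · exact (ContinuousOn.div (by fun_prop) continuousOn_id
      fun t ht => (hx.trans ht).ne').aestronglyMeasurable measurableSet_Ioi
  · refine (MeasureTheory.ae_restrict_mem measurableSet_Ioi).mono fun t ht => ?_
    have ht' : x < t := ht
    rw [Real.norm_of_nonneg (div_nonneg (Real.exp_pos _).le (hx.trans ht').le), div_eq_inv_mul]
    gcongr

theorem hasDerivAt_E₁ {x : ℝ} (hx : 0 < x) : HasDerivAt E₁ (-(Real.exp (-x) / x)) x := by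
  have hcont : ContinuousOn (fun t => Real.exp (-t) / t) (Set.Ioi 0) :=
    ContinuousOn.div (by fun_prop) continuousOn_id fun t ht => ne_of_gt ht
  have h1 : ∀ y > 0, IntervalIntegrable (fun t => Real.exp (-t) / t) MeasureTheory.volume y x :=
    fun y hy => (hcont.mono fun t ht => lt_of_lt_of_le (lt_min hy hx) ht.1).intervalIntegrable
  have h2 : HasDerivAt (fun y => (∫ t in y..x, Real.exp (-t) / t) + E₁ x)
      (-(Real.exp (-x) / x)) x := by
    refine (intervalIntegral.integral_hasDerivAt_left (h1 x hx) ?_ ?_).add_const _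
    · exact hcont.stronglyMeasurableAtFilter isOpen_Ioi x hx
    · exact hcont.continuousAt (Ioi_mem_nhds hx)
  refine h2.congr_of_eventuallyEq ?_
  filter_upwards [Ioi_mem_nhds hx] with y hy
  exact (intervalIntegral.integral_interval_add_Ioi
    (integrableOn_exp_neg_div hy) (integrableOn_exp_neg_div hx)).symm

theorem hasDerivAt_f₁ {z : ℝ} (hz : z < 1) :
    HasDerivAt f₁ ((f₁ z - 1 * (1 - z)) / (1 - z) ^ 2) z := by
  have hz0 : 0 < 1 - z := by linarith
  have hz' : 1 - z ≠ 0 := hz0.ne'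
  have h1 : HasDerivAt (fun y : ℝ => 1 / (1 - y)) (1 / (1 - z) ^ 2) z := by
    refine ((hasDerivAt_const z (1 : ℝ)).div ((hasDerivAt_id z).const_sub 1) hz').congr_deriv ?_
    simp
  have h2 : HasDerivAt (fun y : ℝ => E₁ (1 / (1 - y)))
      (-(Real.exp (-(1 / (1 - z))) / (1 / (1 - z))) * (1 / (1 - z) ^ 2)) z :=
    HasDerivAt.comp (h₂ := E₁) z (hasDerivAt_E₁ (one_div_pos.2 hz0)) h1
  refine (h1.exp.mul h2).congr_deriv ?_
  have h3 : Real.exp (1 / (1 - z)) * Real.exp (-(1 / (1 - z))) = 1 := by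
    rw [← Real.exp_add, add_neg_cancel, Real.exp_zero]
  simp only [f₁]
  field_simp at h3 ⊢
  linear_combination -(1 - z) * h3

theorem a_recurrence (n : ℕ) :
    ((n : ℝ) + 3) * a (n + 3) = (2 * n + 5) * a (n + 2) - (n + 1) * a (n + 1) := by
  have h := maclaurinCoeff_recurrence (fun z => hasDerivAt_f₀) (n + 1)
  push_cast at h
  simp only [a]
  simp at h
  linear_combination h

theorem b_recurrence (n : ℕ) :
    ((n : ℝ) + 3) * b (n + 3) = (2 * n + 5) * b (n + 2) - (n + 1) * b (n + 1) := by
  have h := maclaurinCoeff_recurrence (fun z => hasDerivAt_f₁) (n + 1)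
  push_cast at h
  simp only [b]
  simp at h
  linear_combination h

theorem a_one : a 1 = 1 := by
  simp [a, maclaurinCoeff_one (fun z => hasDerivAt_f₀), f₀]

theorem a_two : a 2 = 3 / 2 := by
  have h := maclaurinCoeff_recurrence (fun z => hasDerivAt_f₀) 0
  have h1 := a_one
  simp only [a] at h1 ⊢
  simp [h1] at h
  linarith

theorem b_two : b 2 = (3 * b 1 + 1) / 2 := by
  have h := maclaurinCoeff_recurrence (fun z => hasDerivAt_f₁) 0
  simp only [b]
  simp at h
  linarith

/-- The discrete Wronskian, constant after normalisation by the recurrence. Its value comes from the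
inhomogeneous initial relation for b_2; b_1 cancels. -/
theorem casoratian (n : ℕ) :
    ((n : ℝ) + 1) * (n + 2) * (a (n + 2) * b (n + 1) - a (n + 1) * b (n + 2)) = -1 := by
  induction n with
  | zero =>
    rw [a_one, a_two, b_two]
    push_cast
    ring
  | succ n ih =>
    push_cast
    linear_combination ih + ((n : ℝ) + 2) * b (n + 2) * a_recurrence n
      - ((n : ℝ) + 2) * a (n + 2) * b_recurrence n

end Coefficients

end HadamardExp
end

noncomputable section
namespace HadamardExp

open PowerSeries Filter Topology

/-! ### Recurrence and normalisation of ρ -/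

section HadamardProduct

theorem ρ_recurrence (n : ℕ) {N : ℝ} (hN : N = n + 3) :
    N * (2 * N - 1) * (N + 1) ^ 2 * ρ (n + 4) + N * (2 * N + 1) * (-3 * N ^ 2 - N + 1) * ρ (n + 3)
      + (N - 1) * (2 * N - 1) * (3 * N ^ 2 + N - 1) * ρ (n + 2)
      - (N - 1) * (N - 2) ^ 2 * (2 * N + 1) * ρ (n + 1) = 0 := by
  have ha := a_recurrence n
  have hb := b_recurrence n
  have ha' := a_recurrence (n + 1)
  have hb' := b_recurrence (n + 1)
  push_cast at ha' hb'
  simp only [ρ]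
  subst hN
  linear_combination ((n : ℝ) + 3) * (2 * n + 5) * (((n : ℝ) + 4) * b (n + 4) * ha'
      + ((2 * n + 7) * a (n + 3) - (n + 2) * a (n + 2)) * hb')
    - ((n : ℝ) + 2) * (2 * n + 7) * (((n : ℝ) + 1) * b (n + 1) * ha
      + ((2 * n + 5) * a (n + 2) - (n + 3) * a (n + 3)) * hb)

/-- From (ab' + a'b)^2 - 4 aa'bb' = (ab' - a'b)^2: the recurrence expresses the mixed sum through ρ,
and the Casoratian gives the right side. -/
theorem ρ_quadratic (n : ℕ) {N : ℝ} (hN : N = n + 3) :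
    (N - 1) ^ 2 * ((N ^ 2 * ρ (n + 3) + (2 * N - 1) ^ 2 * ρ (n + 2) - (N - 2) ^ 2 * ρ (n + 1)) ^ 2
      - 4 * N ^ 2 * (2 * N - 1) ^ 2 * ρ (n + 3) * ρ (n + 2)) = (2 * N - 1) ^ 2 := by
  have hq : N ^ 2 * ρ (n + 3) + (2 * N - 1) ^ 2 * ρ (n + 2) - (N - 2) ^ 2 * ρ (n + 1) =
      N * (2 * N - 1) * (a (n + 3) * b (n + 2) + a (n + 2) * b (n + 3)) := by
    simp only [ρ]
    subst hN
    linear_combination -(((n : ℝ) + 1) * b (n + 1) * a_recurrence n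
      + ((2 * n + 5) * a (n + 2) - (n + 3) * a (n + 3)) * b_recurrence n)
  have hw := casoratian (n + 1)
  push_cast at hw
  rw [hq]
  simp only [ρ]
  subst hN
  linear_combination (2 * (n : ℝ) + 5) ^ 2 * (((n : ℝ) + 2) * (n + 3)
    * (a (n + 3) * b (n + 2) - a (n + 2) * b (n + 3)) - 1) * hw

variable {P : PowerSeries ℝ}

theorem hasExpansion_ρ_shift
    (h : HasExpansion (fun n => (n : ℝ) ^ (3 / 2 : ℝ) * (-2 * ρ n)) P) :
    HasExpansion (fun n => (n : ℝ) ^ (3 / 2 : ℝ) * (-2 * ρ (n + 1))) (shift (3 / 2) 1 P) ∧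
    HasExpansion (fun n => (n : ℝ) ^ (3 / 2 : ℝ) * (-2 * ρ (n - 1))) (shift (3 / 2) (-1) P) ∧
    HasExpansion (fun n => (n : ℝ) ^ (3 / 2 : ℝ) * (-2 * ρ (n - 2))) (shift (3 / 2) (-2) P) := by
  refine ⟨HasExpansion.rpow_mul_shift h 1 (g := fun n => n + 1) ?_,
    HasExpansion.rpow_mul_shift h (-1) (g := fun n => n - 1) ?_,
    HasExpansion.rpow_mul_shift h (-2) (g := fun n => n - 2) ?_⟩
  · exact Eventually.of_forall fun n => by push_cast; rfl
  · filter_upwards [eventually_ge_atTop 1] with n hn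
    push_cast [Nat.cast_sub hn]
    ring
  · filter_upwards [eventually_ge_atTop 2] with n hn
    push_cast [Nat.cast_sub hn]
    ring

theorem hasExpansion_ofNat (k : ℕ) [k.AtLeastTwo] :
    HasExpansion (fun _ => (ofNat(k) : ℝ)) (ofNat(k) : PowerSeries ℝ) := by
  rw [← map_ofNat (C (R := ℝ)) k]
  exact hasExpansion_const _

theorem hasExpansion_one : HasExpansion (fun _ => 1) 1 := by
  simpa using hasExpansion_const 1

theorem recurrenceSeries_eq_zero_of_hasExpansion
    (h : HasExpansion (fun n => (n : ℝ) ^ (3 / 2 : ℝ) * (-2 * ρ n)) P) :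
    recurrenceSeries P = 0 := by
  obtain ⟨h1, hm1, hm2⟩ := hasExpansion_ρ_shift h
  have hu := hasExpansion_inv
  have c1 := hasExpansion_one
  have c2 := hasExpansion_ofNat 2
  have c3 := hasExpansion_ofNat 3
  have hn3 : HasExpansion (fun _ => -3) (-3) := by
    simpa [map_ofNat] using hasExpansion_const (-3)
  refine eq_of_hasExpansion
    ((((((c2.sub hu).mul ((c1.add hu).pow 2)).mul h1).add
    (((c2.add hu).mul ((hn3.sub hu).add (hu.pow 2))).mul h)).add
    ((((c1.sub hu).mul (c2.sub hu)).mul ((c3.add hu).sub (hu.pow 2))).mul hm1)).sub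
    ((((c1.sub hu).mul ((c1.sub (c2.mul hu)).pow 2)).mul (c2.add hu)).mul hm2))
    (by simpa using hasExpansion_const 0) ?_
  filter_upwards [eventually_ge_atTop 3] with n hn
  obtain ⟨m, rfl⟩ := Nat.exists_eq_add_of_le' hn
  rw [show m + 3 + 1 = m + 4 by rfl, show m + 3 - 1 = m + 2 by rfl, show m + 3 - 2 = m + 1 by rfl]
  have hrec := ρ_recurrence m (N := ((m + 3 : ℕ) : ℝ)) (by push_cast; rfl)
  have hN : ((m + 3 : ℕ) : ℝ) ≠ 0 := by positivity
  set N := ((m + 3 : ℕ) : ℝ)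
  generalize N ^ (3 / 2 : ℝ) = t
  have hNu : N * N⁻¹ = 1 := mul_inv_cancel₀ hN
  generalize N⁻¹ = u at hNu
  obtain rfl : u = 1 / N := by field_simp; linarith
  field_simp
  linear_combination -2 * t * hrec

/-- In the expanded quadratic relation the terms of order 0 cancel; order 1/n reads 16 p² = 16, with
p the constant term of P. -/
theorem coeff_zero_sq_of_hasExpansion
    (h : HasExpansion (fun n => (n : ℝ) ^ (3 / 2 : ℝ) * (-2 * ρ n)) P) :
    coeff 0 P ^ 2 = 1 := by
  obtain ⟨-, hm1, hm2⟩ := hasExpansion_ρ_shift h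
  have hu := hasExpansion_inv
  have c1 := hasExpansion_one
  have c2 := hasExpansion_ofNat 2
  have c4 := hasExpansion_ofNat 4
  have key := eq_of_hasExpansion
    (((c1.sub hu).pow 2).mul
      ((((h.add (((c2.sub hu).pow 2).mul hm1)).sub (((c1.sub (c2.mul hu)).pow 2).mul hm2)).pow 2).sub
        (((c4.mul ((c2.sub hu).pow 2)).mul h).mul hm1)))
    ((c4.mul hu).mul ((c2.sub hu).pow 2)) (by
      filter_upwards [eventually_ge_atTop 3] with n hn
      obtain ⟨m, rfl⟩ := Nat.exists_eq_add_of_le' hn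
      rw [show m + 3 - 1 = m + 2 by rfl, show m + 3 - 2 = m + 1 by rfl]
      have hquad := ρ_quadratic m (N := ((m + 3 : ℕ) : ℝ)) (by push_cast; rfl)
      have hN : (0 : ℝ) < ((m + 3 : ℕ) : ℝ) := by positivity
      set N := ((m + 3 : ℕ) : ℝ)
      have ht : (N ^ (3 / 2 : ℝ)) ^ 2 = N ^ 3 := by
        rw [← Real.rpow_natCast, ← Real.rpow_mul hN.le, ← Real.rpow_natCast]
        norm_num
      generalize N ^ (3 / 2 : ℝ) = t at ht
      field_simp
      linear_combination 4 * t ^ 2 * hquad + 4 * (2 * N - 1) ^ 2 * ht)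
  have hc2 : (2 : PowerSeries ℝ) = C 2 := (map_ofNat (C (R := ℝ)) 2).symm
  have hc4 : (4 : PowerSeries ℝ) = C 4 := (map_ofNat (C (R := ℝ)) 4).symm
  have hs (i : ℝ) : constantCoeff (shift (3 / 2) i P) = constantCoeff P := by
    simpa using coeff_zero_shift (3 / 2) i P
  have h1 := congrArg (coeff 1) key
  simp only [hc2, hc4, pow_two, coeff_one_mul, map_sub, map_add, map_mul, hs, coeff_one_shift,
    coeff_one_X, coeff_one, coeff_C, constantCoeff_C, constantCoeff_X, constantCoeff_one,
    coeff_zero_eq_constantCoeff_apply] at h1 ⊢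
  norm_num at h1
  linarith

end HadamardProduct

end HadamardExp

end

/-! ### Conclusion -/

noncomputable section
namespace HadamardExp

open PowerSeries

theorem eq_C_mul_map_mk_d {P : PowerSeries ℝ} (h : recurrenceSeries P = 0) :
    P = C (coeff 0 P) * PowerSeries.map (Rat.castHom ℝ) (PowerSeries.mk d) := by
  refine sub_eq_zero.1 (eq_zero_of_recurrenceSeries_eq_zero ?_ ?_)
  · rw [recurrenceSeries_sub, recurrenceSeries_C_mul, ← map_recurrenceSeries, h,
      recurrenceSeries_mk_d, map_zero, mul_zero, sub_zero]
  · rw [map_sub, coeff_C_mul, coeff_map, coeff_mk, d_zero, map_one, mul_one, sub_self]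

end HadamardExp

end

theorem theorem3 :
    (∀ k : ℕ, ∃ z : ℤ, (k.factorial : ℚ) * HadamardExp.r k = (z : ℚ)) ∧
    (∀ d : ℕ → ℝ,
      HadamardExp.IsAsymptoticSeries
        (fun n : ℕ => -2 * (n : ℝ) ^ (3 / 2 : ℝ) * HadamardExp.ρ n) d →
      ∀ k : ℕ, ∃ z : ℤ, (k.factorial : ℝ) * (2 ^ (6 * k) * d k) = (z : ℝ)) := by
  refine ⟨HadamardExp.exists_int_d, fun d hd k => ?_⟩
  have h : HadamardExp.HasExpansion
      (fun n : ℕ => (n : ℝ) ^ (3 / 2 : ℝ) * (-2 * HadamardExp.ρ n)) (PowerSeries.mk d) :=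
    hd.hasExpansion.congr (Filter.Eventually.of_forall fun n => by ring)
  have h0 := HadamardExp.coeff_zero_sq_of_hasExpansion h
  have hk := congrArg (PowerSeries.coeff k)
    (HadamardExp.eq_C_mul_map_mk_d (HadamardExp.recurrenceSeries_eq_zero_of_hasExpansion h))
  obtain ⟨z, hz⟩ := HadamardExp.exists_int_d k
  have hz' : (k.factorial : ℝ) * (2 ^ (6 * k) * (HadamardExp.d k : ℝ)) = z := by
    exact_mod_cast congrArg (Rat.cast : ℚ → ℝ) hz
  simp only [PowerSeries.coeff_C_mul, PowerSeries.coeff_map, PowerSeries.coeff_mk,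
    eq_ratCast] at hk h0
  -- The sign of the constant term is left open, since integrality is insensitive to it.
  rcases sq_eq_one_iff.1 h0 with h1 | h1
  · exact ⟨z, by rw [hk, h1, one_mul, hz']⟩
  · exact ⟨-z, by rw [hk, h1]; push_cast; linear_combination -hz'⟩
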